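/- Let $\ell,m\ge 3$ be integers with $(\ell-2)(m-2)>4$, and let $X_{\ell,m}$ be the $1$-skeleton of the regular tessellation of the hyperbolic plane by $m$-gons, $\ell$ of them around each vertex. (Combinatorially: let $W=\langle s_0,s_1,s_2\mid s_i^2,\ (s_0s_1)^m,\ (s_1s_2)^\ell,\ (s_0s_2)^2\rangle$ be the symmetry group of the tessellation; the $i$-dimensional cells are the cosets of the subgroup generated by the $s_j$ with $j\ne i$, two cells are incident if the cosets intersect, and two distinct vertices are adjacent in $X_{\ell,m}$ if they are incident to a common edge.) Fix any vertex $*$ of $X_{\ell,m}$, let $|x|$ be the graph distance from $*$ to $x$, let $f_n$ be the number of vertices $x$ with $|x|=n$, and let $F_{\ell,m}(X)=\sum_{x}X^{|x|}=\sum_{n\ge0}f_nX^n$ be the growth series. Then $X_{\ell,m}$ is connected, all $f_n$ are finite, and the growth rate $\lambda=\lim_{n\to\infty}f_n^{1/n}$ exists and is a Salem number. Moreover $F_{\ell,m}$ is the expansion of a rational function, $1/\lambda$ is a pole of it, and every other pole $z\in\mathbb{C}$ satisfies $|z|>1/\lambda$. Here a Salem number is a real algebraic integer $\lambda>1$ such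 that $\lambda^{-1}$ is a conjugate of $\lambda$ and all conjugates of $\lambda$ other than $\lambda$ and $\lambda^{-1}$ have absolute value $1$ (there may be no such further conjugates). -/

import Mathlib

open Filter Topology

/-! ### Salem numbers -/

/-- A real number `x` is a *Salem number* if `x > 1`, `x` is an algebraic integer, `x⁻¹` is a
conjugate of `x`, and all conjugates of `x` other than `x` and `x⁻¹` lie on the unit circle.
(Quadratic units such as `(3 + √5) / 2` are allowed.) -/
def IsSalemNumber (x : ℝ) : Prop :=
  1 < x ∧ IsIntegral ℤ x ∧ Polynomial.aeval x⁻¹ (minpoly ℚ x) = 0 ∧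
    ∀ z : ℂ, Polynomial.aeval z (minpoly ℚ x) = 0 → z ≠ (x : ℂ) → z ≠ (x : ℂ)⁻¹ → ‖z‖ = 1

/-! ### The regular tessellation by `m`-gons, `ℓ` around each vertex -/

/-- The Coxeter matrix of the full symmetry group `[m, ℓ]` of the tessellation by regular
`m`-gons, `ℓ` of them around each vertex. The generators `0, 1, 2` are the reflections in the
sides of a triangle of the barycentric subdivision; reflection `i` moves only the corner of that
triangle at the centre of an `i`-dimensional cell. The angles of the triangle are `π / m` (at the
centre of the face), `π / ℓ` (at the vertex) and `π / 2` (at the midpoint of the edge). -/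
def tessellationMatrix (ℓ m : ℕ) (hℓ : 3 ≤ ℓ) (hm : 3 ≤ m) : CoxeterMatrix (Fin 3) where
  M := !![1, m, 2; m, 1, ℓ; 2, ℓ, 1]
  isSymm := by
    ext i j
    fin_cases i <;> fin_cases j <;> rfl
  diagonal i := by fin_cases i <;> rfl
  off_diagonal i j hij := by
    fin_cases i <;> fin_cases j <;> simp at hij ⊢ <;> omega

/-- The symmetry group of the tessellation, generated by three reflections. -/
abbrev TessellationGroup (ℓ m : ℕ) (hℓ : 3 ≤ ℓ) (hm : 3 ≤ m) : Type :=
  (tessellationMatrix ℓ m hℓ hm).Group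

/-- The stabilizer of the `i`-dimensional cell of the base triangle: it is generated by the two
reflections that fix the centre of that cell. -/
def cellStabilizer (ℓ m : ℕ) (hℓ : 3 ≤ ℓ) (hm : 3 ≤ m) (i : Fin 3) :
    Subgroup (TessellationGroup ℓ m hℓ hm) :=
  Subgroup.closure {g | ∃ j : Fin 3, j ≠ i ∧ g = (tessellationMatrix ℓ m hℓ hm).simple j}

/-- The `i`-dimensional cells of the tessellation: vertices (`i = 0`), edges (`i = 1`) and
`m`-gonal faces (`i = 2`). The symmetry group acts transitively on the cells of each dimension,
so they are the cosets of the stabilizer of one of them. -/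
abbrev TessellationCell (ℓ m : ℕ) (hℓ : 3 ≤ ℓ) (hm : 3 ≤ m) (i : Fin 3) : Type :=
  TessellationGroup ℓ m hℓ hm ⧸ cellStabilizer ℓ m hℓ hm i

/-- Two cells are incident if they belong to a common triangle of the barycentric subdivision;
these triangles correspond to the elements `g` of the symmetry group. -/
def CellIncident (ℓ m : ℕ) (hℓ : 3 ≤ ℓ) (hm : 3 ≤ m) {i j : Fin 3}
    (c : TessellationCell ℓ m hℓ hm i) (d : TessellationCell ℓ m hℓ hm j) : Prop :=
  ∃ g : TessellationGroup ℓ m hℓ hm,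
    (QuotientGroup.mk g : TessellationCell ℓ m hℓ hm i) = c ∧
      (QuotientGroup.mk g : TessellationCell ℓ m hℓ hm j) = d

/-- The graph `X_{ℓ,m}`: the 1-skeleton of the tessellation. Two distinct vertices are adjacent if
some edge of the tessellation is incident to both. -/
def tessellationGraph (ℓ m : ℕ) (hℓ : 3 ≤ ℓ) (hm : 3 ≤ m) :
    SimpleGraph (TessellationCell ℓ m hℓ hm 0) where
  Adj u v := u ≠ v ∧ ∃ e : TessellationCell ℓ m hℓ hm 1,
    CellIncident ℓ m hℓ hm u e ∧ CellIncident ℓ m hℓ hm v e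
  symm := ⟨fun _ _ ⟨h, e, hu, hv⟩ => ⟨h.symm, e, hv, hu⟩⟩
  loopless := ⟨fun _ h => h.1 rfl⟩

/-! ### Growth of graphs -/

/-- The set of vertices of `G` at distance `n` from `o`. -/
def graphSphere {V : Type*} (G : SimpleGraph V) (o : V) (n : ℕ) : Set V :=
  {x | G.edist o x = n}

/-- The growth series `∑ₓ X ^ |x| = ∑ₙ fₙ X ^ n` of `G` with base vertex `o`, where `|x|` is the
distance from `o` to `x` and `fₙ` is the number of vertices with `|x| = n`. -/
noncomputable def growthSeries {V : Type*} (G : SimpleGraph V) (o : V) : PowerSeries ℂ :=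
  PowerSeries.mk fun n => ((graphSphere G o n).ncard : ℂ)

/-- `lam` is the growth rate of `G` with base vertex `o`: the limit of the `n`-th root of the
number of vertices at distance `n` from `o`. -/
def HasGrowthRate {V : Type*} (G : SimpleGraph V) (o : V) (lam : ℝ) : Prop :=
  Tendsto (fun n : ℕ => ((graphSphere G o n).ncard : ℝ) ^ ((1 : ℝ) / n)) atTop (𝓝 lam)

/-- `z` is a pole of the power series `F`: `F` is the expansion of a rational function `P / Q` in
lowest terms, and `Q` vanishes at `z`. -/
def IsPoleOf (F : PowerSeries ℂ) (z : ℂ) : Prop :=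
  ∃ P Q : Polynomial ℂ, IsCoprime P Q ∧ (Q : PowerSeries ℂ) * F = (P : PowerSeries ℂ) ∧ Q.IsRoot z

/-! ### The contragredient geometric representation of a Coxeter group -/

namespace CoxeterMatrix

variable {B : Type*} (M : CoxeterMatrix B)

/-! Chambers of the barycentric subdivision are the elements of `W`. Vertices, edges and faces are
the cosets of three rank two parabolic subgroups, each with a unique shortest element (`IsMinimal`).
Descents of `w` are read off from the signs of the roots `w α i` at a point of the fundamental
chamber (`rootValue_pos`). In the hyperbolic case the orbit of this point stays in a light cone
(`lightCone`), which forbids certain combinations of descents.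

A candidate distance `level` is built by climbing from the base chamber. Crossing an edge raises it
by one unless the edge is horizontal, as happens for the top edge of a face with `m` odd whose
bottom edge is not horizontal. The two ways around any rank two coset give the same rise, so the
level does not depend on the path (`level_mul_simple_aux`). Levels change by at most one along an
edge, and every nonbase vertex has a neighbour one level lower; hence level is graph distance
(`tessellationGraph_edist`).

Let `F`, `G`, `H` count vertices, edges and faces by the level of their shortest chamber.
Inclusion-exclusion over descents gives `F - G + H = 1` (`weightSeries_euler`). Counting all
chambers by each kind of cell gives two more linear equations, with the horizontal cells counted
separately for odd `m`. Elimination writes `F` as `N / Q` (`weightSeries_of_even`,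
`weightSeries_of_odd`).

The denominator satisfies `(1 - X) * Q = A - X * D`, where `A / D` maps the unit disc into itself.
Zeros of `Q` in the disc are fixed points of this map, so by the Schwarz lemma there is at most one,
and it is simple (`root_unique_and_simple`). Since `Q(0) = 1` and, by hyperbolicity, `Q(1) < 0`,
there is one, `r`, in `(0, 1)`. The zeros of `Q` are closed under inversion, so all others except
`r⁻¹` lie on the unit circle and `r⁻¹` is a Salem number (`isSalemNumber_inv`). Since `r` is a
simple dominant pole, `r⁻¹` is also the growth rate (`exists_salem_growth`). -/

theorem proj_coroot (i : B) :
    (LinearMap.proj i : Module.Dual ℝ (B → ℝ)) (fun l => -2 * Real.cos (Real.pi / M l i)) = 2 := by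
  simp

/-- The action of a simple reflection on the dual of the geometric representation, in the
coordinates given by the simple roots. -/
noncomputable def dualReflection (i : B) : (B → ℝ) ≃ₗ[ℝ] (B → ℝ) :=
  Module.reflection (M.proj_coroot i)

theorem dualReflection_apply (i : B) (y : B → ℝ) (l : B) :
    M.dualReflection i y l = y l + 2 * Real.cos (Real.pi / M l i) * y i := by
  simp only [dualReflection, Module.reflection_apply, LinearMap.proj_apply, Pi.sub_apply,
    Pi.smul_apply, smul_eq_mul]
  ring

/-- The product of the two reflections rotates by `2θ` with `θ = π / M i j`. Its powers are given by
Chebyshev polynomials at `2 cos 2θ`, which are quotients of sines that vanish or cancel at this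
exponent. -/
theorem dualReflection_mul_pow (hM : ∀ i j, M i j ≠ 0) (i j : B) :
    (M.dualReflection i * M.dualReflection j) ^ M i j = 1 := by
  rcases eq_or_ne i j with rfl | hij
  · rw [M.diagonal, pow_one]
    ext y : 1
    exact Module.involutive_reflection (M.proj_coroot i) y
  have h1 : M i j ≠ 1 := M.off_diagonal i j hij
  have h0 := hM i j
  have key := fun z => Module.reflection_mul_reflection_pow_apply (M.proj_coroot i)
    (M.proj_coroot j) (M i j) z
  ext z : 1
  change ((Module.reflection (M.proj_coroot i) * Module.reflection (M.proj_coroot j)) ^ M i j) z = z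
  rw [key]
  simp only [LinearMap.proj_apply, M.symmetric j i]
  generalize M i j = n at h0 h1
  -- For `n = 2` the denominator `sin 2θ` of the Chebyshev quotient vanishes, so this case is
  -- computed directly.
  rcases eq_or_ne n 2 with rfl | h2
  · norm_num
    ext l
    simp
    ring
  have hn : 3 ≤ n := by omega
  have hn' : (3 : ℝ) ≤ n := by exact_mod_cast hn
  set θ : ℝ := Real.pi / n with hθ
  have hnθ : (n : ℝ) * θ = Real.pi := by rw [hθ]; field_simp
  have hpos : 0 < θ := by rw [hθ]; have := Real.pi_pos; positivity
  have hs : Real.sin (2 * θ) ≠ 0 := by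
    apply ne_of_gt
    apply Real.sin_pos_of_pos_of_lt_pi <;> nlinarith
  have ht : -2 * Real.cos θ * (-2 * Real.cos θ) - 2 = 2 * Real.cos (2 * θ) := by
    rw [Real.cos_two_mul]; ring
  rw [ht]
  have hS : ∀ k : ℤ, (Polynomial.Chebyshev.S ℝ k).eval (2 * Real.cos (2 * θ)) =
      Real.sin ((k + 1) * (2 * θ)) / Real.sin (2 * θ) := by
    intro k
    rw [eq_div_iff hs, Polynomial.Chebyshev.S_two_mul_real_cos]
  simp only [hS]
  rcases Nat.even_or_odd' n with ⟨k, hk | hk⟩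
  · have e1 : ((n : ℤ) - 2) / 2 = k - 1 := by omega
    have e2 : ((n : ℤ) - 1) / 2 = k - 1 := by omega
    have hz : Real.sin ((((k : ℤ) - 1 : ℤ) + 1) * (2 * θ)) = 0 := by
      push_cast
      rw [show ((k : ℝ) - 1 + 1) * (2 * θ) = n * θ by rw [hk]; push_cast; ring, hnθ, Real.sin_pi]
    rw [e1, e2, hz]
    simp
  · have e1 : ((n : ℤ) - 2) / 2 = k - 1 := by omega
    have e2 : ((n : ℤ) - 1) / 2 = k := by omega
    have e3 : ((n : ℤ) - 3) / 2 = k - 1 := by omega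
    have e4 : (n : ℤ) / 2 = k := by omega
    have hz : Real.sin (((k : ℤ) + 1) * (2 * θ)) + Real.sin ((((k : ℤ) - 1 : ℤ) + 1) * (2 * θ)) = 0 := by
      push_cast
      rw [show ((k : ℝ) - 1 + 1) * (2 * θ) = Real.pi - θ by rw [← hnθ, hk]; push_cast; ring,
        show ((k : ℝ) + 1) * (2 * θ) = θ + Real.pi by rw [← hnθ, hk]; push_cast; ring,
        Real.sin_add_pi, Real.sin_pi_sub]
      ring
    rw [e1, e2, e3, e4, ← add_div, hz]
    simp

end CoxeterMatrix

/-! ### Signs of roots, descents, and cosets of rank two parabolic subgroups -/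

namespace CoxeterSystem

variable {B W : Type*} [Group W] {M : CoxeterMatrix B} (cs : CoxeterSystem M W)

/-- The dual of the geometric representation. -/
noncomputable def dualRep (hM : ∀ i j, M i j ≠ 0) : W →* ((B → ℝ) ≃ₗ[ℝ] (B → ℝ)) :=
  cs.lift ⟨M.dualReflection, M.dualReflection_mul_pow hM⟩

/-- The values at `x` of the roots `w α i`. -/
noncomputable def rootValue (hM : ∀ i j, M i j ≠ 0) (x : B → ℝ) (w : W) : B → ℝ :=
  cs.dualRep hM w⁻¹ x

variable (hM : ∀ i j, M i j ≠ 0) (x : B → ℝ)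

@[simp]
theorem rootValue_one : cs.rootValue hM x 1 = x := by simp [rootValue]

theorem rootValue_mul_simple (w : W) (j l : B) :
    cs.rootValue hM x (w * cs.simple j) l =
      cs.rootValue hM x w l + 2 * Real.cos (Real.pi / M l j) * cs.rootValue hM x w j := by
  have h : cs.dualRep hM (cs.simple j) = M.dualReflection j :=
    cs.lift_apply_simple (M.dualReflection_mul_pow hM) j
  rw [rootValue, mul_inv_rev, map_mul, LinearEquiv.mul_apply, inv_simple, h,
    CoxeterMatrix.dualReflection_apply]
  rfl

theorem rootValue_mul_simple_self (w : W) (j : B) :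
    cs.rootValue hM x (w * cs.simple j) j = -cs.rootValue hM x w j := by
  rw [rootValue_mul_simple, M.diagonal]
  simp
  ring

/-- The product of `k` simple reflections, alternating between `i` and `j` and starting with
`i`. -/
def alt (i j : B) (k : ℕ) : W := (cs.wordProd (alternatingWord j i k))⁻¹

@[simp]
theorem alt_zero (i j : B) : cs.alt i j 0 = 1 := by simp [alt, alternatingWord]

theorem alt_succ (i j : B) (k : ℕ) :
    cs.alt i j (k + 1) = cs.alt i j k * cs.simple (if Even k then i else j) := by
  rw [alt, alternatingWord_succ', wordProd_cons, mul_inv_rev, inv_simple, alt]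

theorem alt_one (i j : B) : cs.alt i j 1 = cs.simple i := by simp [alt_succ]

theorem alt_two (i j : B) : cs.alt i j 2 = cs.simple i * cs.simple j := by
  simp [alt_succ]

theorem alt_succ_mul (i j : B) (k : ℕ) :
    cs.alt i j (k + 1) * cs.simple (if Even k then i else j) = cs.alt i j k := by
  rw [alt_succ, simple_mul_simple_cancel_right]

theorem alt_braid (i j : B) : cs.alt i j (M i j) = cs.alt j i (M i j) := by
  have := cs.wordProd_braidWord_eq j i
  rw [braidWord, braidWord, M.symmetric j i] at this
  rw [alt, alt, this]

theorem length_alt_le (i j : B) (k : ℕ) : cs.length (cs.alt i j k) ≤ k := by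
  rw [alt, length_inv]
  exact (cs.length_wordProd_le _).trans (by simp)

theorem length_alt_lt (hM : ∀ i j, M i j ≠ 0) (i j : B) {k : ℕ} (hk : M i j < k) : cs.length (cs.alt i j k) < k := by
  have h := cs.not_isReduced_alternatingWord j i (m := k) (hM j i) (by rwa [M.symmetric j i])
  have h' := cs.length_wordProd_le (alternatingWord j i k)
  rw [IsReduced] at h
  rw [length_alternatingWord] at h h'
  rw [alt, length_inv]
  omega

/-- `u` is the shortest element of its coset modulo the parabolic subgroup generated by `i`
and `j`. -/
def IsMinimal (i j : B) (u : W) : Prop := ¬cs.IsRightDescent u i ∧ ¬cs.IsRightDescent u j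

theorem IsMinimal.symm {cs : CoxeterSystem M W} {i j : B} {u : W} (h : cs.IsMinimal i j u) :
    cs.IsMinimal j i u := ⟨h.2, h.1⟩

theorem isRightDescent_mul_simple {w : W} {i : B} (h : ¬cs.IsRightDescent w i) :
    cs.IsRightDescent (w * cs.simple i) i := by
  rw [isRightDescent_iff_not_isRightDescent_mul, simple_mul_simple_cancel_right]
  exact h

theorem not_isRightDescent_mul_simple {w : W} {i : B} (h : cs.IsRightDescent w i) :
    ¬cs.IsRightDescent (w * cs.simple i) i :=
  (cs.isRightDescent_iff_not_isRightDescent_mul).1 h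

/-- Strip descents from the right. Once `i` is removed it is no longer a descent, so the next letter
must be `j` or the process stops; the stripped word therefore alternates by itself. -/
theorem exists_isMinimal_mul_alt_of_isRightDescent (n : ℕ) : ∀ (w : W) (i j : B),
    cs.length w ≤ n → cs.IsRightDescent w i →
    ∃ u k, cs.IsMinimal i j u ∧ w = u * cs.wordProd (alternatingWord j i (k + 1)) ∧
      cs.length w = cs.length u + (k + 1) := by
  induction n with
  | zero =>
    intro w i j hn hi
    have := hi
    rw [IsRightDescent] at this
    omega
  | succ n ih =>
    intro w i j hn hi
    have hl := (cs.isRightDescent_iff).1 hi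
    have hni := cs.not_isRightDescent_mul_simple hi
    by_cases hj : cs.IsRightDescent (w * cs.simple i) j
    · obtain ⟨u, k, hu, hw, hlen⟩ := ih (w * cs.simple i) j i (by omega) hj
      refine ⟨u, k + 1, hu.symm, ?_, by omega⟩
      rw [alternatingWord_succ j i, wordProd_concat, ← mul_assoc, ← hw,
        simple_mul_simple_cancel_right]
    · refine ⟨w * cs.simple i, 0, ⟨hni, hj⟩, ?_, by omega⟩
      simp [alternatingWord]

theorem wordProd_alternatingWord_eq_alt (i j : B) (k : ℕ) :
    cs.wordProd (alternatingWord j i k) = if Even k then cs.alt j i k else cs.alt i j k := by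
  induction k generalizing i j with
  | zero => simp [alternatingWord]
  | succ k ih =>
    rw [alternatingWord_succ, wordProd_concat, ih, alt_succ, alt_succ]
    by_cases h : Even k <;> simp [h, Nat.even_add_one]

/-- Every element decomposes, with additive lengths, into a minimal coset representative and an
alternating product. -/
theorem exists_isMinimal_mul_alt_length (w : W) (i j : B) :
    ∃ u k, cs.IsMinimal i j u ∧ (w = u * cs.alt i j k ∨ w = u * cs.alt j i k) ∧
      cs.length w = cs.length u + k := by
  have aux : ∀ i j, cs.IsRightDescent w i → ∃ u k, cs.IsMinimal i j u ∧
      (w = u * cs.alt i j k ∨ w = u * cs.alt j i k) ∧ cs.length w = cs.length u + k := by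
    intro i j hi
    obtain ⟨u, k, hu, hw, hl⟩ :=
      cs.exists_isMinimal_mul_alt_of_isRightDescent _ w i j le_rfl hi
    refine ⟨u, k + 1, hu, ?_, hl⟩
    rw [wordProd_alternatingWord_eq_alt] at hw
    split_ifs at hw
    exacts [Or.inr hw, Or.inl hw]
  by_cases hi : cs.IsRightDescent w i
  · exact aux i j hi
  by_cases hj : cs.IsRightDescent w j
  · obtain ⟨u, k, hu, hw, hl⟩ := aux j i hj
    exact ⟨u, k, hu.symm, hw.symm, hl⟩
  · exact ⟨w, 0, ⟨hi, hj⟩, by simp, by simp⟩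

/-- Along an alternating path the two root values satisfy the recurrence of `sin kθ`, namely `2 cos
θ sin kθ = sin (k+1)θ + sin (k-1)θ`. Multiplying by `sin θ` avoids division. -/
theorem sin_mul_rootValue_mul_alt (u : W) (i j : B) (k : ℕ) :
    Real.sin (Real.pi / M i j) *
        cs.rootValue hM x (u * cs.alt i j k) (if Even k then i else j) =
      Real.sin ((k + 1) * (Real.pi / M i j)) * cs.rootValue hM x u i +
        Real.sin (k * (Real.pi / M i j)) * cs.rootValue hM x u j ∧
    Real.sin (Real.pi / M i j) *
        cs.rootValue hM x (u * cs.alt i j k) (if Even k then j else i) =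
      -(Real.sin (k * (Real.pi / M i j)) * cs.rootValue hM x u i +
        Real.sin ((k - 1) * (Real.pi / M i j)) * cs.rootValue hM x u j) := by
  set θ := Real.pi / M i j with hθ
  induction k with
  | zero => simp
  | succ k ih =>
    obtain ⟨h1, h2⟩ := ih
    have hc : 2 * Real.cos θ * Real.sin ((k + 1) * θ) =
        Real.sin ((k + 1 + 1) * θ) + Real.sin (k * θ) := by
      rw [show ((k : ℝ) + 1 + 1) * θ = (k + 1) * θ + θ by ring,
        show (k : ℝ) * θ = (k + 1) * θ - θ by ring, Real.sin_add, Real.sin_sub]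
      ring
    have hc' : 2 * Real.cos θ * Real.sin (k * θ) =
        Real.sin ((k + 1) * θ) + Real.sin ((k - 1) * θ) := by
      rw [show ((k : ℝ) + 1) * θ = k * θ + θ by ring,
        show ((k : ℝ) - 1) * θ = k * θ - θ by ring, Real.sin_add, Real.sin_sub]
      ring
    have hM' : M j i = M i j := M.symmetric j i
    rw [alt_succ, ← mul_assoc]
    push_cast
    rw [add_sub_cancel_right]
    by_cases hk : Even k
    · have hk' : ¬Even (k + 1) := by rwa [Nat.even_add_one, not_not]
      simp only [hk, hk', if_true, if_false] at h1 h2 ⊢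
      rw [rootValue_mul_simple, rootValue_mul_simple_self, hM', ← hθ]
      constructor
      · linear_combination h2 + 2 * Real.cos θ * h1 + cs.rootValue hM x u i * hc +
          cs.rootValue hM x u j * hc'
      · linear_combination -h1
    · have hk' : Even (k + 1) := by rwa [Nat.even_add_one]
      simp only [hk, hk', if_true, if_false] at h1 h2 ⊢
      rw [rootValue_mul_simple, rootValue_mul_simple_self, ← hθ]
      constructor
      · linear_combination h2 + 2 * Real.cos θ * h1 + cs.rootValue hM x u i * hc +
          cs.rootValue hM x u j * hc'
      · linear_combination -h1

variable {x} in
theorem rootValue_mul_alt_pos {u : W} {i j : B} (hij : i ≠ j) {k : ℕ} (hk : k < M i j)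
    (hi : 0 < cs.rootValue hM x u i) (hj : 0 < cs.rootValue hM x u j) :
    0 < cs.rootValue hM x (u * cs.alt i j k) (if Even k then i else j) := by
  have h := (cs.sin_mul_rootValue_mul_alt hM x u i j k).1
  have h1 := M.off_diagonal i j hij
  generalize M i j = n at *
  have hn : 2 ≤ n := by omega
  have hn' : (2 : ℝ) ≤ n := by exact_mod_cast hn
  set θ := Real.pi / n
  have hθ : 0 < θ := div_pos Real.pi_pos (by linarith)
  have hnθ : (n : ℝ) * θ = Real.pi := mul_div_cancel₀ _ (by linarith)
  have hs : 0 < Real.sin θ := Real.sin_pos_of_pos_of_lt_pi hθ (by nlinarith)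
  refine pos_of_mul_pos_right (a := Real.sin θ) ?_ hs.le
  rw [h]
  rcases Nat.eq_zero_or_pos k with rfl | hk0
  · simp only [Nat.cast_zero, zero_add, one_mul, zero_mul, Real.sin_zero, add_zero]
    positivity
  · have hkn : (k : ℝ) + 1 ≤ n := by exact_mod_cast hk
    have hk0' : (0 : ℝ) < k := by exact_mod_cast hk0
    have s1 : 0 ≤ Real.sin ((k + 1) * θ) :=
      Real.sin_nonneg_of_nonneg_of_le_pi (by positivity) (by nlinarith)
    have s2 : 0 < Real.sin (k * θ) :=
      Real.sin_pos_of_pos_of_lt_pi (by positivity) (by nlinarith)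
    positivity

variable {x} in
/-- A root `w α i` is positive if and only if `i` is not a right descent of `w`. -/
theorem rootValue_pos (hx : ∀ i, 0 < x i) (n : ℕ) : ∀ (w : W) (j : B), cs.length w ≤ n →
    ¬cs.IsRightDescent w j → 0 < cs.rootValue hM x w j := by
  induction n with
  | zero =>
    intro w j hn _
    rw [Nat.le_zero, length_eq_zero_iff] at hn
    simpa [hn] using hx j
  | succ n ih =>
    intro w j hn hj
    by_cases hw : w = 1
    · simpa [hw] using hx j
    obtain ⟨i, hi⟩ := cs.exists_rightDescent_of_ne_one hw
    have hij : i ≠ j := fun h => hj (h ▸ hi)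
    -- Both root values at the shorter element `u` are positive by induction, and the sine formula
    -- carries positivity along the alternating path to `w`.
    obtain ⟨u, k, hu, hwk, hl⟩ := cs.exists_isMinimal_mul_alt_length w i j
    have hk0 : k ≠ 0 := by
      rintro rfl
      simp only [alt_zero, mul_one, or_self] at hwk
      exact hu.1 (hwk ▸ hi)
    have hui := ih u i (by omega) hu.1
    have huj := ih u j (by omega) hu.2
    have key : ∀ a b, (a = i ∧ b = j ∨ a = j ∧ b = i) → w = u * cs.alt a b k →
        0 < cs.rootValue hM x w j := by
      intro a b hab hwa
      have hMab : ∀ v, cs.IsRightDescent v a → cs.IsRightDescent v b → v ≠ w := by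
        rintro v h1 h2 rfl
        rcases hab with ⟨rfl, rfl⟩ | ⟨rfl, rfl⟩
        exacts [hj h2, hj h1]
      have hle : k ≤ M a b := by
        by_contra hlt
        have h1 := cs.length_alt_lt hM a b (not_le.1 hlt)
        have h2 := cs.length_mul_le u (cs.alt a b k)
        rw [← hwa] at h2
        omega
      have hd : ∀ c d, w = u * cs.alt c d k →
          cs.IsRightDescent w (if Even (k - 1) then c else d) := by
        intro c d hcd
        obtain ⟨k', rfl⟩ := Nat.exists_eq_succ_of_ne_zero hk0
        rw [IsRightDescent, hcd, Nat.succ_eq_add_one, mul_assoc, Nat.add_sub_cancel, alt_succ_mul,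
          ← hcd]
        have h1 := cs.length_mul_le u (cs.alt c d k')
        have h2 := cs.length_alt_le c d k'
        omega
      -- At `k = M a b` the braid relation gives a second spelling with the other last letter, so
      -- both letters, including `j`, would be descents.
      have hlt : k < M a b := by
        refine lt_of_le_of_ne hle fun hk => ?_
        have h1 := hd a b hwa
        have h2 := hd b a (by rw [hwa, hk, cs.alt_braid])
        split_ifs at h1 h2
        exacts [hMab w h1 h2 rfl, hMab w h2 h1 rfl]
      have hab' : a ≠ b := by
        rcases hab with ⟨rfl, rfl⟩ | ⟨rfl, rfl⟩
        exacts [hij, hij.symm]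
      have hpos : 0 < cs.rootValue hM x (u * cs.alt a b k) (if Even k then a else b) := by
        apply cs.rootValue_mul_alt_pos hM hab' hlt <;>
        rcases hab with ⟨rfl, rfl⟩ | ⟨rfl, rfl⟩ <;> assumption
      have h1 := hd a b hwa
      rw [← hwa] at hpos
      have hpar : Even (k - 1) ↔ ¬Even k := by
        obtain ⟨k', rfl⟩ := Nat.exists_eq_succ_of_ne_zero hk0
        rw [Nat.succ_eq_add_one, Nat.add_sub_cancel, Nat.even_add_one, not_not]
      simp only [hpar] at h1
      by_cases hk : Even k <;> simp only [hk, not_true, not_false_iff, if_true, if_false] at h1 hpos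
      · rcases hab with ⟨rfl, rfl⟩ | ⟨rfl, rfl⟩
        exacts [absurd h1 hj, hpos]
      · rcases hab with ⟨rfl, rfl⟩ | ⟨rfl, rfl⟩
        exacts [hpos, absurd h1 hj]
    rcases hwk with h | h
    exacts [key i j (Or.inl ⟨rfl, rfl⟩) h, key j i (Or.inr ⟨rfl, rfl⟩) h]

variable {x} in
theorem isRightDescent_iff_rootValue_neg (hx : ∀ i, 0 < x i) {w : W} {j : B} :
    cs.IsRightDescent w j ↔ cs.rootValue hM x w j < 0 := by
  constructor
  · intro h
    have := cs.rootValue_pos hM hx _ _ j le_rfl (cs.not_isRightDescent_mul_simple h)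
    rw [rootValue_mul_simple_self] at this
    linarith
  · intro h
    by_contra h'
    exact (cs.rootValue_pos hM hx _ _ j le_rfl h').not_gt h

variable {x} in
theorem not_isRightDescent_iff_rootValue_pos (hx : ∀ i, 0 < x i) {w : W} {j : B} :
    ¬cs.IsRightDescent w j ↔ 0 < cs.rootValue hM x w j := by
  refine ⟨cs.rootValue_pos hM hx _ _ j le_rfl, fun h h' => ?_⟩
  exact ((cs.isRightDescent_iff_rootValue_neg hM hx).1 h').not_gt h

theorem not_isRightDescent_mul_alt (hM : ∀ i j, M i j ≠ 0) {u : W} {i j : B} (hij : i ≠ j) (hu : cs.IsMinimal i j u)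
    {k : ℕ} (hk : k < M i j) :
    ¬cs.IsRightDescent (u * cs.alt i j k) (if Even k then i else j) := by
  have hx : ∀ _ : B, (0 : ℝ) < 1 := fun _ => one_pos
  rw [cs.not_isRightDescent_iff_rootValue_pos hM (x := fun _ => 1) hx]
  exact cs.rootValue_mul_alt_pos hM hij hk
    ((cs.not_isRightDescent_iff_rootValue_pos hM hx).1 hu.1)
    ((cs.not_isRightDescent_iff_rootValue_pos hM hx).1 hu.2)

theorem length_mul_alt (hM : ∀ i j, M i j ≠ 0) {u : W} {i j : B} (hij : i ≠ j) (hu : cs.IsMinimal i j u)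
    {k : ℕ} (hk : k ≤ M i j) : cs.length (u * cs.alt i j k) = cs.length u + k := by
  induction k with
  | zero => simp
  | succ k ih =>
    have := (cs.not_isRightDescent_iff).1 (cs.not_isRightDescent_mul_alt hM hij hu hk)
    rw [alt_succ, ← mul_assoc, this, ih (by omega), add_assoc]

theorem isRightDescent_mul_alt_succ (hM : ∀ i j, M i j ≠ 0) {u : W} {i j : B} (hij : i ≠ j) (hu : cs.IsMinimal i j u)
    {k : ℕ} (hk : k < M i j) :
    cs.IsRightDescent (u * cs.alt i j (k + 1)) (if Even k then i else j) := by
  rw [alt_succ, ← mul_assoc]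
  exact cs.isRightDescent_mul_simple (cs.not_isRightDescent_mul_alt hM hij hu hk)

theorem isRightDescent_mul_alt_longest (hM : ∀ i j, M i j ≠ 0) {u : W} {i j : B} (hij : i ≠ j) (hu : cs.IsMinimal i j u) :
    cs.IsRightDescent (u * cs.alt i j (M i j)) i ∧
      cs.IsRightDescent (u * cs.alt i j (M i j)) j := by
  obtain ⟨k, hk⟩ := Nat.exists_eq_succ_of_ne_zero (hM i j)
  have h1 := cs.isRightDescent_mul_alt_succ hM hij hu (k := k) (by omega)
  have h2 := cs.isRightDescent_mul_alt_succ hM hij.symm hu.symm (k := k)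
    (by rw [M.symmetric j i]; omega)
  rw [← Nat.succ_eq_add_one, ← hk] at h1 h2
  rw [← cs.alt_braid] at h2
  split_ifs at h1 h2
  exacts [⟨h1, h2⟩, ⟨h2, h1⟩]

/-- Every element is the product of a minimal coset representative and an alternating product. -/
theorem exists_isMinimal_mul_alt (hM : ∀ i j, M i j ≠ 0) (w : W) (i j : B) :
    ∃ u, cs.IsMinimal i j u ∧ ((∃ k < M i j, w = u * cs.alt i j k) ∨
      ∃ k < M i j, w = u * cs.alt j i (k + 1)) := by
  obtain ⟨u, k, hu, hw, hl⟩ := cs.exists_isMinimal_mul_alt_length w i j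
  refine ⟨u, hu, ?_⟩
  have hMs : M j i = M i j := M.symmetric j i
  have hle : k ≤ M i j := by
    by_contra hlt
    have h1 := cs.length_alt_lt hM i j (not_le.1 hlt)
    have h1' := cs.length_alt_lt hM j i (k := k) (by omega)
    rcases hw with hw | hw
    · have h2 := cs.length_mul_le u (cs.alt i j k)
      rw [← hw] at h2
      omega
    · have h2 := cs.length_mul_le u (cs.alt j i k)
      rw [← hw] at h2
      omega
  rcases Nat.lt_or_ge k (M i j) with hk | hk
  · rcases hw with hw | hw
    · exact Or.inl ⟨k, hk, hw⟩
    · rcases Nat.eq_zero_or_pos k with rfl | hk0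
      · exact Or.inl ⟨0, hk, by simpa using hw⟩
      · exact Or.inr ⟨k - 1, by omega, by rwa [Nat.sub_add_cancel hk0]⟩
  -- The longest element has two spellings; it is assigned to the second family and the identity to
  -- the first, so that the two families are disjoint.
  · have hk' : k = M i j := by omega
    have h0 := hM i j
    refine Or.inr ⟨k - 1, by omega, ?_⟩
    rw [Nat.sub_add_cancel (by omega)]
    rcases hw with hw | hw
    · rw [hw, hk', cs.alt_braid]
    · exact hw

/-- Appending a letter to an alternating word of length at most `M i j` lengthens it, cancels its
last letter, or, at the longest element, cancels after a braid move. -/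
theorem mem_closure_pair (hM : ∀ i j, M i j ≠ 0) {i j : B} {g : W}
    (hg : g ∈ Subgroup.closure {cs.simple i, cs.simple j}) :
    ∃ k ≤ M i j, g = cs.alt i j k ∨ g = cs.alt j i k := by
  have step : ∀ a b k, k ≤ M a b → ∀ c, (c = a ∨ c = b) →
      ∃ k' ≤ M a b, cs.alt a b k * cs.simple c = cs.alt a b k' ∨
        cs.alt a b k * cs.simple c = cs.alt b a k' := by
    intro a b k hk c hc
    have h0 := hM a b
    by_cases hck : c = if Even k then a else b
    · rcases hk.lt_or_eq with hlt | rfl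
      · exact ⟨k + 1, hlt, Or.inl (by rw [hck, alt_succ])⟩
      · obtain ⟨n, hn⟩ := Nat.exists_eq_succ_of_ne_zero h0
        refine ⟨n, by omega, Or.inr ?_⟩
        rw [cs.alt_braid, hn, Nat.succ_eq_add_one, ← cs.alt_succ_mul b a n, hck, hn]
        by_cases hev : Even n <;> simp [hev, Nat.even_add_one]
    · rcases k with _ | k
      · refine ⟨1, by omega, Or.inr ?_⟩
        have : c = b := by simpa [show c ≠ a by simpa using hck] using hc
        rw [alt_zero, one_mul, alt_one, this]
      · refine ⟨k, by omega, Or.inl ?_⟩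
        rw [← cs.alt_succ_mul a b k]
        congr 2
        by_cases hev : Even k <;> simp [hev, Nat.even_add_one] at hck ⊢ <;> tauto
  have step' : ∀ x c, (∃ k ≤ M i j, x = cs.alt i j k ∨ x = cs.alt j i k) → (c = i ∨ c = j) →
      ∃ k ≤ M i j, x * cs.simple c = cs.alt i j k ∨ x * cs.simple c = cs.alt j i k := by
    rintro x c ⟨k, hk, rfl | rfl⟩ hc
    · exact step i j k hk c hc
    · obtain ⟨k', hk', h⟩ := step j i k (by rwa [M.symmetric j i]) c hc.symm
      exact ⟨k', by rwa [M.symmetric j i] at hk', h.symm⟩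
  induction hg using Subgroup.closure_induction_right with
  | one => exact ⟨0, Nat.zero_le _, by simp⟩
  | mul_right x _ y hy ih =>
    rcases hy with rfl | rfl
    exacts [step' x i ih (Or.inl rfl), step' x j ih (Or.inr rfl)]
  | mul_inv_cancel x _ y hy ih =>
    rcases hy with rfl | rfl <;> rw [inv_simple]
    exacts [step' x i ih (Or.inl rfl), step' x j ih (Or.inr rfl)]

theorem alt_mem_closure_pair (i j : B) (k : ℕ) :
    cs.alt i j k ∈ Subgroup.closure {cs.simple i, cs.simple j} := by
  induction k with
  | zero => simp
  | succ k ih =>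
    rw [alt_succ]
    refine mul_mem ih (Subgroup.subset_closure ?_)
    split_ifs <;> simp

theorem alt_mem_closure_pair' (i j : B) (k : ℕ) :
    cs.alt j i k ∈ Subgroup.closure {cs.simple i, cs.simple j} := by
  rw [Set.pair_comm]
  exact cs.alt_mem_closure_pair j i k

/-- A coset of a rank two parabolic subgroup has only one minimal element. -/
theorem IsMinimal.eq_of_mem_closure {cs : CoxeterSystem M W} (hM : ∀ i j, M i j ≠ 0) {i j : B}
    (hij : i ≠ j) {u u' : W} (hu : cs.IsMinimal i j u) (hu' : cs.IsMinimal i j u')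
    (h : u⁻¹ * u' ∈ Subgroup.closure {cs.simple i, cs.simple j}) : u = u' := by
  have aux : ∀ a b k, a ≠ b → cs.IsMinimal a b u → cs.IsMinimal a b u' → k ≤ M a b →
      u⁻¹ * u' = cs.alt a b k → u = u' := by
    intro a b k hab hu hu' hk he
    rw [inv_mul_eq_iff_eq_mul] at he
    rcases k with _ | k
    · simpa using he.symm
    · have := cs.isRightDescent_mul_alt_succ hM hab hu hk
      rw [← he] at this
      split_ifs at this
      exacts [absurd this hu'.1, absurd this hu'.2]
  obtain ⟨k, hk, hg | hg⟩ := cs.mem_closure_pair hM h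
  · exact aux i j k hij hu hu' hk hg
  · exact aux j i k hij.symm hu.symm hu'.symm (by rwa [M.symmetric j i]) hg

theorem mul_alt_injective (hM : ∀ i j, M i j ≠ 0) {u u' : W} {i j : B} (hij : i ≠ j)
    (hu : cs.IsMinimal i j u) (hu' : cs.IsMinimal i j u') {k k' : ℕ} (hk : k ≤ M i j)
    (hk' : k' ≤ M i j) (h : u * cs.alt i j k = u' * cs.alt i j k') : u = u' ∧ k = k' := by
  have hmem : u⁻¹ * u' ∈ Subgroup.closure {cs.simple i, cs.simple j} := by
    have : u⁻¹ * u' = cs.alt i j k * (cs.alt i j k')⁻¹ := by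
      rw [eq_mul_inv_iff_mul_eq, mul_assoc, inv_mul_eq_iff_eq_mul, h]
    rw [this]
    exact mul_mem (cs.alt_mem_closure_pair i j k) (inv_mem (cs.alt_mem_closure_pair i j k'))
  obtain rfl := hu.eq_of_mem_closure hM hij hu' hmem
  refine ⟨rfl, ?_⟩
  have h1 := cs.length_mul_alt hM hij hu hk
  have h2 := cs.length_mul_alt hM hij hu hk'
  rw [h, h2] at h1
  omega

theorem mul_alt_ne_mul_alt (hM : ∀ i j, M i j ≠ 0) {u u' : W} {i j : B} (hij : i ≠ j)
    (hu : cs.IsMinimal i j u) (hu' : cs.IsMinimal i j u') {k k' : ℕ} (hk : k < M i j)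
    (hk' : k' < M i j) : u * cs.alt i j k ≠ u' * cs.alt j i (k' + 1) := by
  intro h
  have hmem : u⁻¹ * u' ∈ Subgroup.closure {cs.simple i, cs.simple j} := by
    have : u⁻¹ * u' = cs.alt i j k * (cs.alt j i (k' + 1))⁻¹ := by
      rw [eq_mul_inv_iff_mul_eq, mul_assoc, inv_mul_eq_iff_eq_mul, h]
    rw [this]
    exact mul_mem (cs.alt_mem_closure_pair i j k) (inv_mem (cs.alt_mem_closure_pair' i j (k' + 1)))
  obtain rfl := hu.eq_of_mem_closure hM hij hu' hmem
  have h1 := cs.length_mul_alt hM hij hu hk.le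
  have h2 := cs.length_mul_alt hM hij.symm hu.symm (k := k' + 1) (by rw [M.symmetric j i]; omega)
  obtain rfl : k = k' + 1 := by
    rw [h, h2] at h1
    omega
  have h3 := cs.not_isRightDescent_mul_alt hM hij hu hk
  have h4 := cs.isRightDescent_mul_alt_succ hM hij.symm hu.symm (k := k')
    (by rw [M.symmetric j i]; omega)
  rw [h] at h3
  by_cases hev : Even k' <;> simp [hev, Nat.even_add_one] at h3 h4 <;> contradiction

end CoxeterSystem

/-! ### Hyperbolic triangle groups with a right angle -/

/-- `M` is the Coxeter matrix of a hyperbolic triangle group with a right angle. -/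
structure CoxeterMatrix.IsHyperbolic (M : CoxeterMatrix (Fin 3)) : Prop where
  three_le_face : 3 ≤ M 0 1
  three_le_vertex : 3 ≤ M 1 2
  edge : M 0 2 = 2
  hyperbolic : 4 < (M 1 2 - 2) * (M 0 1 - 2)

/-- The hypothesis says `π/l < π/2 - π/m`, hence `cos (π/l) > sin (π/m)`. The conclusion is what
makes the geometric form Lorentzian. -/
theorem one_lt_cos_sq_add_cos_sq {l m : ℕ} (hl : 3 ≤ l) (hm : 3 ≤ m)
    (h : 4 < (l - 2) * (m - 2)) :
    1 < Real.cos (Real.pi / m) ^ 2 + Real.cos (Real.pi / l) ^ 2 := by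
  obtain ⟨l, rfl⟩ := Nat.exists_eq_add_of_le' (show 2 ≤ l by omega)
  obtain ⟨m, rfl⟩ := Nat.exists_eq_add_of_le' (show 2 ≤ m by omega)
  simp only [Nat.add_sub_cancel] at h
  have hl' : (0 : ℝ) < l := by exact_mod_cast (show 0 < l by omega)
  have hm' : (0 : ℝ) < m := by exact_mod_cast (show 0 < m by omega)
  have h' : (4 : ℝ) < l * m := by exact_mod_cast h
  have hpi := Real.pi_pos
  push_cast
  have hlt : Real.pi / (l + 2) < Real.pi / 2 - Real.pi / (m + 2) := by
    rw [div_sub_div _ _ (by norm_num) (by positivity), div_lt_div_iff₀ (by positivity) (by positivity)]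
    nlinarith
  have hcos := Real.cos_lt_cos_of_nonneg_of_le_pi (show 0 ≤ Real.pi / (l + 2) by positivity)
    (show Real.pi / 2 - Real.pi / (m + 2) ≤ Real.pi by
      have : 0 < Real.pi / (m + 2) := by positivity
      linarith) hlt
  rw [Real.cos_pi_div_two_sub] at hcos
  have hs : 0 ≤ Real.sin (Real.pi / (m + 2)) :=
    Real.sin_nonneg_of_nonneg_of_le_pi (by positivity)
      (div_le_self hpi.le (by linarith))
  nlinarith [Real.sin_sq_add_cos_sq (Real.pi / (m + 2) : ℝ)]

theorem cos_pi_div_nonneg {t : ℝ} (ht : 2 ≤ t) : 0 ≤ Real.cos (Real.pi / t) := by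
  have hp := Real.pi_pos
  apply Real.cos_nonneg_of_neg_pi_div_two_le_of_le
  · have : 0 ≤ Real.pi / t := by positivity
    linarith
  · exact div_le_div_of_nonneg_left hp.le (by norm_num) ht

/-- The middle reflection does not swap the two halves of the cone. With `K = a² + b² - 4`, the new
value is a combination of `Y` and `S = a y₀ + b y₂`. Cauchy-Schwarz bounds `S²` by `(K + 4)(y₀² +
y₂²)`, and `K (K + 4) < (K + 2)²` closes the estimate. -/
theorem lightCone_reflection {a b y₀ y₁ y₂ : ℝ} (hab : 4 < a ^ 2 + b ^ 2)
    (h1 : 0 < y₁ + (a * y₀ + b * y₂) / 2)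
    (h2 : (a ^ 2 + b ^ 2 - 4) / 4 * (y₀ ^ 2 + y₂ ^ 2) < (y₁ + (a * y₀ + b * y₂) / 2) ^ 2) :
    0 < -y₁ + (a * (y₀ + a * y₁) + b * (y₂ + b * y₁)) / 2 := by
  obtain ⟨Y, hY⟩ : ∃ Y, Y = y₁ + (a * y₀ + b * y₂) / 2 := ⟨_, rfl⟩
  obtain ⟨S, hS⟩ : ∃ S, S = a * y₀ + b * y₂ := ⟨_, rfl⟩
  obtain ⟨K, hK⟩ : ∃ K, K = a ^ 2 + b ^ 2 - 4 := ⟨_, rfl⟩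
  have hSn : S ^ 2 ≤ (K + 4) * (y₀ ^ 2 + y₂ ^ 2) := by
    rw [hS, hK]
    nlinarith [sq_nonneg (a * y₂ - b * y₀)]
  rw [← hY] at h1 h2
  rw [← hK] at h2
  have hK0 : 0 < K := by linarith
  have e : -y₁ + (a * (y₀ + a * y₁) + b * (y₂ + b * y₁)) / 2 = (K + 2) / 2 * Y - K * S / 4 := by
    rw [hY, hS, hK]; ring
  rw [e]
  by_contra hneg
  have h3 : 2 * (K + 2) * Y ≤ K * S := by linarith
  have h4 : (2 * (K + 2) * Y) ^ 2 ≤ (K * S) ^ 2 := pow_le_pow_left₀ (by positivity) h3 2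
  have h5 : K ^ 2 * S ^ 2 ≤ K ^ 2 * ((K + 4) * (y₀ ^ 2 + y₂ ^ 2)) := by gcongr
  have h6 : K * (K + 4) * (K * (y₀ ^ 2 + y₂ ^ 2)) ≤ K * (K + 4) * (4 * Y ^ 2) :=
    mul_le_mul_of_nonneg_left (by linarith) (by positivity)
  nlinarith [sq_nonneg Y, pow_pos h1 2]

namespace CoxeterMatrix.IsHyperbolic

variable {W : Type*} [Group W] {M : CoxeterMatrix (Fin 3)} (hyp : M.IsHyperbolic)
  (cs : CoxeterSystem M W)

include hyp

theorem ne_zero (i j : Fin 3) : M i j ≠ 0 := by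
  have h1 := hyp.three_le_face
  have h2 := hyp.three_le_vertex
  have h3 := hyp.edge
  have s1 := M.symmetric 1 0
  have s2 := M.symmetric 2 1
  have s3 := M.symmetric 2 0
  have d0 := M.diagonal 0
  have d1 := M.diagonal 1
  have d2 := M.diagonal 2
  fin_cases i <;> fin_cases j <;> simp <;> omega

/-- The quadratic form and the linear form cutting out the future light cone. -/
theorem lightCone (w : W) :
    let y := cs.rootValue hyp.ne_zero ![1, 2, 1] w
    let a := 2 * Real.cos (Real.pi / M 0 1)
    let b := 2 * Real.cos (Real.pi / M 1 2)
    0 < y 1 + (a * y 0 + b * y 2) / 2 ∧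
      (a ^ 2 + b ^ 2 - 4) / 4 * (y 0 ^ 2 + y 2 ^ 2) < (y 1 + (a * y 0 + b * y 2) / 2) ^ 2 := by
  have hK := one_lt_cos_sq_add_cos_sq hyp.three_le_vertex hyp.three_le_face hyp.hyperbolic
  have h10 : M 1 0 = M 0 1 := M.symmetric 1 0
  have h21 : M 2 1 = M 1 2 := M.symmetric 2 1
  have h20 : M 2 0 = M 0 2 := M.symmetric 2 0
  have hc2 : Real.cos (Real.pi / (2 : ℕ)) = 0 := by simp
  intro y a b
  have hab : 4 < a ^ 2 + b ^ 2 := by simp only [a, b]; nlinarith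
  simp only [y]
  induction w using cs.simple_induction_right with
  -- At the base point `![1, 2, 1]` the linear form is at least `2`, while `a, b ≤ 2` bounds the
  -- left side of the quadratic inequality by `2`.
  | one =>
    have ha : 0 ≤ a := by
      have : (2 : ℝ) ≤ M 0 1 := by exact_mod_cast (show 2 ≤ M 0 1 by linarith [hyp.three_le_face])
      exact mul_nonneg zero_le_two (cos_pi_div_nonneg this)
    have hb : 0 ≤ b := by
      have : (2 : ℝ) ≤ M 1 2 := by exact_mod_cast (show 2 ≤ M 1 2 by linarith [hyp.three_le_vertex])
      exact mul_nonneg zero_le_two (cos_pi_div_nonneg this)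
    have ha2 : a ≤ 2 := by linarith [Real.cos_le_one (Real.pi / M 0 1)]
    have hb2 : b ≤ 2 := by linarith [Real.cos_le_one (Real.pi / M 1 2)]
    simp
    constructor <;> nlinarith
  | mul_simple_right w i ih =>
    simp only [CoxeterSystem.rootValue_mul_simple]
    set y := cs.rootValue hyp.ne_zero ![1, 2, 1] w with hy
    obtain ⟨h1, h2⟩ := ih
    -- Reflections `0` and `2` fix the linear form; reflection `1` only preserves its sign. All
    -- three preserve the quadratic form.
    fin_cases i <;>
      simp only [M.diagonal, hyp.edge, h10, h21, h20, hc2, Fin.zero_eta, Fin.mk_one,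
        Fin.reduceFinMk, Nat.cast_one, div_one, Real.cos_pi]
    · constructor
      · convert h1 using 1; ring
      · convert h2 using 1 <;> ring
    · constructor
      · convert lightCone_reflection hab h1 h2 using 1
        simp only [a, b]
        ring
      · rw [← sub_pos] at h2 ⊢
        convert h2 using 1
        simp only [a, b]
        ring
    · constructor
      · convert h1 using 1; ring
      · convert h2 using 1 <;> ring

theorem isRightDescent_iff (w : W) (i : Fin 3) :
    cs.IsRightDescent w i ↔ cs.rootValue hyp.ne_zero ![1, 2, 1] w i < 0 :=
  cs.isRightDescent_iff_rootValue_neg hyp.ne_zero (by intro i; fin_cases i <;> simp)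

/-- Three negative root values would make the linear form of `lightCone` negative, as its
coefficients are nonnegative. -/
theorem not_isRightDescent_all {w : W} (h0 : cs.IsRightDescent w 0) (h1 : cs.IsRightDescent w 1) :
    ¬cs.IsRightDescent w 2 := by
  intro h2
  rw [hyp.isRightDescent_iff cs] at h0 h1 h2
  have h := (hyp.lightCone cs w).1
  have ha : 0 ≤ Real.cos (Real.pi / M 0 1) :=
    cos_pi_div_nonneg (by exact_mod_cast (show 2 ≤ M 0 1 by linarith [hyp.three_le_face]))
  have hb : 0 ≤ Real.cos (Real.pi / M 1 2) :=
    cos_pi_div_nonneg (by exact_mod_cast (show 2 ≤ M 1 2 by linarith [hyp.three_le_vertex]))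
  have e1 := mul_nonneg ha (neg_nonneg.2 h0.le)
  have e2 := mul_nonneg hb (neg_nonneg.2 h2.le)
  linarith

/-- The two root values in question add up to twice the linear form of `lightCone`, which is
positive. -/
theorem not_isRightDescent_both {w : W} (h0 : cs.IsRightDescent (w * cs.simple 0) 1) :
    ¬cs.IsRightDescent (w * cs.simple 2) 1 := by
  intro h2
  rw [hyp.isRightDescent_iff cs, cs.rootValue_mul_simple] at h0 h2
  have h := (hyp.lightCone cs w).1
  rw [M.symmetric 1 0] at h0
  linarith

/-- Multiplication by one of two commuting simple reflections does not affect the other one. -/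
theorem isRightDescent_mul_simple_zero (w : W) :
    cs.IsRightDescent (w * cs.simple 0) 2 ↔ cs.IsRightDescent w 2 := by
  rw [hyp.isRightDescent_iff cs, hyp.isRightDescent_iff cs, cs.rootValue_mul_simple, M.symmetric 2 0,
    hyp.edge]
  simp

theorem isRightDescent_mul_simple_two (w : W) :
    cs.IsRightDescent (w * cs.simple 2) 0 ↔ cs.IsRightDescent w 0 := by
  rw [hyp.isRightDescent_iff cs, hyp.isRightDescent_iff cs, cs.rootValue_mul_simple, hyp.edge]
  simp

theorem simple_zero_mul_simple_two : cs.simple 0 * cs.simple 2 = cs.simple 2 * cs.simple 0 := by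
  have h := cs.alt_braid 0 2
  rwa [hyp.edge, cs.alt_two, cs.alt_two] at h

end CoxeterMatrix.IsHyperbolic

/-! ### Horizontal edges and levels -/

namespace CoxeterSystem

variable {W : Type*} [Group W] {M : CoxeterMatrix (Fin 3)} (cs : CoxeterSystem M W)

/-- Crossing the edge of the chamber `w` does not change the distance to the base vertex. This
happens if and only if the faces have odd length and the edge is opposite to the lowest vertex of
a face, both edges of which at this vertex are not horizontal. -/
def IsHorizontal (w : W) : Prop :=
  Odd (M 0 1) ∧ ∃ u, ∃ _ : cs.length u < cs.length w, cs.IsMinimal 0 1 u ∧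
    (w = u * cs.alt 0 1 (M 0 1 - 1) ∨ w * cs.simple 2 = u * cs.alt 0 1 (M 0 1 - 1)) ∧
    ¬IsHorizontal u
  termination_by cs.length w

open Classical in
/-- The change of level when passing from the chamber `w` to the adjacent chamber `w * s i` further
away from the base chamber. -/
noncomputable def step (i : Fin 3) (w : W) : ℕ := if i = 0 ∧ ¬cs.IsHorizontal w then 1 else 0

open Classical in
/-- The distance from the base vertex to the vertex of the chamber `w`. -/
noncomputable def level (w : W) : ℕ :=
  if h : ∃ i, cs.IsRightDescent w i then
    level (w * cs.simple h.choose) + cs.step h.choose (w * cs.simple h.choose)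
  else 0
  termination_by cs.length w
  decreasing_by exact h.choose_spec

@[simp]
theorem level_one : cs.level 1 = 0 := by
  rw [level, dif_neg]
  rintro ⟨i, hi⟩
  exact cs.not_isRightDescent_one i hi

theorem step_zero {w : W} (h : ¬cs.IsHorizontal w) : cs.step 0 w = 1 := if_pos ⟨rfl, h⟩

theorem step_zero_of_isHorizontal {w : W} (h : cs.IsHorizontal w) : cs.step 0 w = 0 :=
  if_neg fun h' => h'.2 h

theorem step_of_ne {i : Fin 3} (hi : i ≠ 0) (w : W) : cs.step i w = 0 := if_neg fun h => hi h.1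

theorem step_le_one (i : Fin 3) (w : W) : cs.step i w ≤ 1 := by
  unfold step
  split_ifs <;> simp

/-- The change of level along an alternating path. -/
noncomputable def rise (i j : Fin 3) (u : W) (k : ℕ) : ℕ :=
  ∑ t ∈ Finset.range k, cs.step (if Even t then i else j) (u * cs.alt i j t)

theorem rise_succ (i j : Fin 3) (u : W) (k : ℕ) :
    cs.rise i j u (k + 1) =
      cs.rise i j u k + cs.step (if Even k then i else j) (u * cs.alt i j k) :=
  Finset.sum_range_succ _ _

end CoxeterSystem

/-! ### Horizontal edges of a face, and path independence of the level -/

namespace CoxeterMatrix.IsHyperbolic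

variable {W : Type*} [Group W] {M : CoxeterMatrix (Fin 3)} (hyp : M.IsHyperbolic)
  (cs : CoxeterSystem M W)

include hyp

/-- The length condition needed for the recursion is automatic: the top chamber is at least two
longer than `u`, and a factor `s 2` changes the length by one. -/
theorem isHorizontal_iff {w : W} : cs.IsHorizontal w ↔
    Odd (M 0 1) ∧ ∃ u, cs.IsMinimal 0 1 u ∧
      (w = u * cs.alt 0 1 (M 0 1 - 1) ∨ w * cs.simple 2 = u * cs.alt 0 1 (M 0 1 - 1)) ∧
      ¬cs.IsHorizontal u := by
  rw [CoxeterSystem.IsHorizontal]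
  refine and_congr_right fun _ => exists_congr fun u => ?_
  constructor
  · rintro ⟨_, h⟩
    exact h
  · intro h
    refine ⟨?_, h⟩
    have hm := hyp.three_le_face
    have hl := cs.length_mul_alt hyp.ne_zero (by decide : (0 : Fin 3) ≠ 1) h.1
      (k := M 0 1 - 1) (by omega)
    rcases h.2.1 with h' | h' <;> rw [← h'] at hl
    · omega
    · have := cs.length_mul_simple w 2
      omega

theorem isHorizontal_mul_simple_two {w : W} :
    cs.IsHorizontal (w * cs.simple 2) ↔ cs.IsHorizontal w := by
  rw [hyp.isHorizontal_iff, hyp.isHorizontal_iff, cs.simple_mul_simple_cancel_right]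
  simp only [or_comm]

/-- Position of the top edge of a face of odd length. -/
theorem descents_top (hodd : Odd (M 0 1)) {u : W} (hu : cs.IsMinimal 0 1 u) :
    (¬cs.IsRightDescent (u * cs.alt 0 1 (M 0 1 - 1)) 0 ∧
      ¬cs.IsRightDescent (u * cs.alt 0 1 (M 0 1 - 1)) 2) ∧
    cs.IsRightDescent (u * cs.alt 0 1 (M 0 1 - 1)) 1 ∧
    cs.IsRightDescent (u * cs.alt 0 1 (M 0 1 - 1) * cs.simple 0) 1 := by
  have h01 : (0 : Fin 3) ≠ 1 := by decide
  have hm := hyp.three_le_face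
  obtain ⟨p, hp⟩ := hodd
  have h1 := cs.not_isRightDescent_mul_alt hyp.ne_zero h01 hu (k := M 0 1 - 1) (by omega)
  have h2 := cs.isRightDescent_mul_alt_succ hyp.ne_zero h01 hu (k := M 0 1 - 2) (by omega)
  have h3 := cs.isRightDescent_mul_alt_longest hyp.ne_zero h01 hu
  have e1 : Even (M 0 1 - 1) := ⟨p, by omega⟩
  have e2 : ¬Even (M 0 1 - 2) := by
    rw [Nat.not_even_iff_odd]
    exact ⟨p - 1, by omega⟩
  have e3 : M 0 1 - 2 + 1 = M 0 1 - 1 := by omega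
  have e4 : u * cs.alt 0 1 (M 0 1) = u * cs.alt 0 1 (M 0 1 - 1) * cs.simple 0 := by
    conv_lhs => rw [show M 0 1 = M 0 1 - 1 + 1 by omega]
    rw [cs.alt_succ, if_pos e1, mul_assoc]
  rw [if_pos e1] at h1
  rw [if_neg e2, e3] at h2
  rw [e4] at h3
  refine ⟨⟨h1, ?_⟩, h2, h3.2⟩
  rw [← hyp.isRightDescent_mul_simple_zero]
  exact hyp.not_isRightDescent_all cs h3.1 h3.2

/-- A chamber that is neither the lowest nor the top left one in its face does not have a
horizontal edge above it. -/
theorem isHorizontal_iff_of_isRightDescent {w : W} (h1 : cs.IsRightDescent w 1) :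
    cs.IsHorizontal w ↔ Odd (M 0 1) ∧ ∃ u, cs.IsMinimal 0 1 u ∧
      w = u * cs.alt 0 1 (M 0 1 - 1) ∧ ¬cs.IsHorizontal u := by
  rw [hyp.isHorizontal_iff]
  refine and_congr_right fun hodd => exists_congr fun u => and_congr_right fun hu => ?_
  refine and_congr_left fun _ => or_iff_left fun h => ?_
  have ht := hyp.descents_top cs hodd hu
  rw [← h] at ht
  refine hyp.not_isRightDescent_both cs ht.2.2 ?_
  rwa [cs.simple_mul_simple_cancel_right]

/-- The lowest chamber of a face is determined by its top left chamber, so the witness in the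
definition can only be `u`. -/
theorem isHorizontal_top (hodd : Odd (M 0 1)) {u : W} (hu : cs.IsMinimal 0 1 u) :
    cs.IsHorizontal (u * cs.alt 0 1 (M 0 1 - 1)) ↔ ¬cs.IsHorizontal u := by
  have hm := hyp.three_le_face
  rw [hyp.isHorizontal_iff_of_isRightDescent cs (hyp.descents_top cs hodd hu).2.1]
  constructor
  · rintro ⟨_, u', hu', h, hn⟩
    rwa [(cs.mul_alt_injective hyp.ne_zero (by decide) hu hu' (by omega) (by omega) h).1]
  · exact fun h => ⟨hodd, u, hu, rfl, h⟩

theorem not_isHorizontal_left {u : W} (hu : cs.IsMinimal 0 1 u) {k : ℕ} (hk : Even k)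
    (hk0 : k ≠ 0) (hkm : k < M 0 1 - 1) : ¬cs.IsHorizontal (u * cs.alt 0 1 k) := by
  have hd := cs.isRightDescent_mul_alt_succ hyp.ne_zero (by decide) hu (k := k - 1) (by omega)
  have hk' : ¬Even (k - 1) := by
    rw [← Nat.even_add_one, Nat.sub_add_cancel (by omega)]
    exact hk
  rw [if_neg hk', Nat.sub_add_cancel (by omega)] at hd
  rw [hyp.isHorizontal_iff_of_isRightDescent cs hd]
  rintro ⟨_, u', hu', h, _⟩
  have := (cs.mul_alt_injective hyp.ne_zero (by decide) hu hu' (by omega) (by omega) h).2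
  omega

/-- Such a chamber has descent `1`, so it would have to be a top left chamber, against uniqueness of
the coset decomposition. In particular, of the two edges at the lowest vertex only the left one can
be horizontal. -/
theorem not_isHorizontal_right {u : W} (hu : cs.IsMinimal 0 1 u) {k : ℕ} (hk : ¬Even k)
    (hkm : k < M 0 1) : ¬cs.IsHorizontal (u * cs.alt 1 0 k) := by
  have hm := hyp.three_le_face
  have hs : M 1 0 = M 0 1 := M.symmetric 1 0
  have hk0 : k ≠ 0 := by rintro rfl; simp at hk
  have hd := cs.isRightDescent_mul_alt_succ hyp.ne_zero (by decide) hu.symm (k := k - 1)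
    (by omega)
  have hk' : Even (k - 1) := by
    rw [← not_not (a := Even (k - 1)), ← Nat.even_add_one, Nat.sub_add_cancel (by omega)]
    exact hk
  rw [if_pos hk', Nat.sub_add_cancel (by omega)] at hd
  rw [hyp.isHorizontal_iff_of_isRightDescent cs hd]
  rintro ⟨_, u', hu', h, _⟩
  have := cs.mul_alt_ne_mul_alt hyp.ne_zero (by decide) hu' hu (k := M 0 1 - 1) (k' := k - 1)
    (by omega) (by omega)
  rw [Nat.sub_add_cancel (by omega)] at this
  exact this h.symm

theorem rise_right {u : W} (hu : cs.IsMinimal 0 1 u) {k : ℕ} (hk : k ≤ M 0 1) :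
    cs.rise 1 0 u k = k / 2 := by
  induction k with
  | zero => simp [CoxeterSystem.rise]
  | succ k ih =>
    rw [cs.rise_succ, ih (by omega)]
    by_cases hev : Even k
    · rw [if_pos hev, cs.step_of_ne (by decide)]
      obtain ⟨r, rfl⟩ := hev
      omega
    · rw [if_neg hev, cs.step_zero (hyp.not_isHorizontal_right cs hu hev (by omega))]
      rw [Nat.not_even_iff_odd] at hev
      obtain ⟨r, rfl⟩ := hev
      omega

omit hyp in
theorem rise_left_of_even (heven : Even (M 0 1)) {u : W} {k : ℕ} :
    cs.rise 0 1 u k = (k + 1) / 2 := by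
  induction k with
  | zero => simp [CoxeterSystem.rise]
  | succ k ih =>
    have hh : ∀ w, ¬cs.IsHorizontal w := by
      intro w h
      rw [CoxeterSystem.IsHorizontal] at h
      exact (Nat.not_even_iff_odd.2 h.1) heven
    rw [cs.rise_succ, ih]
    by_cases hev : Even k
    · rw [if_pos hev, cs.step_zero (hh _)]
      obtain ⟨r, rfl⟩ := hev
      omega
    · rw [if_neg hev, cs.step_of_ne (by decide)]
      rw [Nat.not_even_iff_odd] at hev
      obtain ⟨r, rfl⟩ := hev
      omega

/-- The bound stops short of crossing the top edge, so the bottom edge is the only one on this side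
that may be horizontal. -/
theorem rise_left {u : W} (hu : cs.IsMinimal 0 1 u) {k : ℕ} (hk : k + 2 ≤ M 0 1) :
    cs.rise 0 1 u (k + 1) = cs.step 0 u + k / 2 := by
  induction k with
  | zero => simp [CoxeterSystem.rise]
  | succ k ih =>
    rw [cs.rise_succ, ih (by omega)]
    by_cases hev : Even (k + 1)
    · rw [if_pos hev,
        cs.step_zero (hyp.not_isHorizontal_left cs hu hev (by omega) (by omega))]
      obtain ⟨r, hr⟩ := hev
      omega
    · rw [if_neg hev, cs.step_of_ne (i := 1) (by decide)]
      rw [Nat.not_even_iff_odd] at hev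
      obtain ⟨r, hr⟩ := hev
      omega

/-- For odd length `2r + 1` the right side has `r` rising edges and the left side `r + 1` edges, of
which exactly one, the bottom or the top one, is horizontal. The recursive definition of
`IsHorizontal` is made for this balance. -/
theorem rise_face {u : W} (hu : cs.IsMinimal 0 1 u) :
    cs.rise 0 1 u (M 0 1) = cs.rise 1 0 u (M 0 1) := by
  have hm := hyp.three_le_face
  rw [hyp.rise_right cs hu le_rfl]
  rcases Nat.even_or_odd (M 0 1) with hev | hodd
  · rw [rise_left_of_even cs hev]
    obtain ⟨r, hr⟩ := hev
    omega
  · have h := hyp.rise_left cs hu (k := M 0 1 - 2) (by omega)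
    have e : M 0 1 = M 0 1 - 2 + 1 + 1 := by omega
    have e' : M 0 1 - 2 + 1 = M 0 1 - 1 := by omega
    have hev : Even (M 0 1 - 1) := Nat.Odd.sub_odd hodd odd_one
    conv_lhs => rw [e]
    rw [cs.rise_succ, h, e', if_pos hev]
    have hodd' := hodd
    obtain ⟨r, hr⟩ := hodd
    by_cases hu' : cs.IsHorizontal u
    · rw [cs.step_zero_of_isHorizontal hu', cs.step_zero]
      · omega
      · rw [hyp.isHorizontal_top cs hodd' hu, not_not]
        exact hu'
    · rw [cs.step_zero hu', cs.step_zero_of_isHorizontal]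
      · omega
      · exact (hyp.isHorizontal_top cs hodd' hu).2 hu'

theorem rise_longest {i j : Fin 3} (hij : i ≠ j) {u : W} (hu : cs.IsMinimal i j u) :
    cs.rise i j u (M i j) = cs.rise j i u (M i j) := by
  have e02 : cs.rise 0 2 u 2 = cs.rise 2 0 u 2 := by
    simp only [CoxeterSystem.rise, Finset.sum_range_succ, Finset.range_one, Finset.sum_singleton,
      zero_add, Even.zero, if_true, Nat.not_even_one, if_false,
      cs.step_of_ne (show (2 : Fin 3) ≠ 0 by decide), cs.alt_zero, cs.alt_one, mul_one, add_zero]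
    by_cases h : cs.IsHorizontal u
    · rw [cs.step_zero_of_isHorizontal h, cs.step_zero_of_isHorizontal]
      rwa [hyp.isHorizontal_mul_simple_two]
    · rw [cs.step_zero h, cs.step_zero]
      rwa [hyp.isHorizontal_mul_simple_two]
  have e12 : ∀ k, cs.rise 1 2 u k = cs.rise 2 1 u k := by
    intro k
    unfold CoxeterSystem.rise
    refine Finset.sum_congr rfl fun t _ => ?_
    rw [cs.step_of_ne, cs.step_of_ne] <;> split_ifs <;> decide
  have h20 : M 2 0 = 2 := (M.symmetric 2 0).trans hyp.edge
  have h10 : M 1 0 = M 0 1 := M.symmetric 1 0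
  fin_cases i <;> fin_cases j <;>
    simp only [Fin.zero_eta, Fin.mk_one, Fin.reduceFinMk, ne_eq, not_true] at hij hu ⊢
  · exact hyp.rise_face cs hu
  · rw [hyp.edge, e02]
  · rw [h10]
    exact (hyp.rise_face cs hu.symm).symm
  · exact e12 _
  · rw [h20, e02]
  · exact (e12 _).symm

/-- The value of `level` is independent of the chosen descent, by a diamond argument. If `i` and `j`
are both descents, then `w` is the longest element of a rank two coset, and `rise_longest` compares
the two paths to it from the shortest one. -/
theorem level_mul_simple_aux (n : ℕ) : ∀ (w : W) (i : Fin 3), cs.length w ≤ n →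
    cs.IsRightDescent w i →
    cs.level w = cs.level (w * cs.simple i) + cs.step i (w * cs.simple i) := by
  induction n with
  | zero =>
    intro w i hn hi
    rw [CoxeterSystem.IsRightDescent] at hi
    omega
  | succ n ih =>
    intro w i hn hi
    have hex : ∃ i, cs.IsRightDescent w i := ⟨i, hi⟩
    rw [CoxeterSystem.level, dif_pos hex]
    obtain ⟨j, hj, hjd⟩ : ∃ j, j = hex.choose ∧ cs.IsRightDescent w j :=
      ⟨_, rfl, hex.choose_spec⟩
    rw [← hj]
    clear hj
    rcases eq_or_ne i j with rfl | hij
    · rfl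
    obtain ⟨u, hu, hw⟩ := cs.exists_isMinimal_mul_alt hyp.ne_zero w i j
    have h0 := hyp.ne_zero i j
    have hs : M j i = M i j := M.symmetric j i
    -- Every element of the coset other than the longest one lacks one of the descents `i`, `j`.
    have hw' : w = u * cs.alt i j (M i j) := by
      rcases hw with ⟨k, hk, hw⟩ | ⟨k, hk, hw⟩
      · have := cs.not_isRightDescent_mul_alt hyp.ne_zero hij hu hk
        rw [← hw] at this
        split_ifs at this <;> contradiction
      · by_cases hk' : k + 1 = M i j
        · rw [hw, hk', cs.alt_braid]
        · have := cs.not_isRightDescent_mul_alt hyp.ne_zero hij.symm hu.symm (k := k + 1)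
            (by omega)
          rw [← hw] at this
          split_ifs at this <;> contradiction
    have path : ∀ a b, a ≠ b → cs.IsMinimal a b u → w = u * cs.alt a b (M a b) → ∀ k < M a b,
        cs.level (u * cs.alt a b k) = cs.level u + cs.rise a b u k := by
      intro a b hab hu hw k hk
      induction k with
      | zero => simp [CoxeterSystem.rise]
      | succ k ihk =>
        have hlw := cs.length_mul_alt hyp.ne_zero hab hu le_rfl
        have hlk := cs.length_mul_alt hyp.ne_zero hab hu hk.le
        rw [← hw] at hlw
        have := ih (u * cs.alt a b (k + 1)) _ (by omega)
          (cs.isRightDescent_mul_alt_succ hyp.ne_zero hab hu (k := k) (by omega))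
        rw [this, mul_assoc, cs.alt_succ_mul, ihk (by omega), cs.rise_succ, add_assoc]
    have last : ∀ a b, a ≠ b → cs.IsMinimal a b u → w = u * cs.alt a b (M a b) →
        ∃ c, (c = a ∨ c = b) ∧ (c = if Even (M a b - 1) then a else b) ∧
        cs.level (w * cs.simple c) + cs.step c (w * cs.simple c) =
          cs.level u + cs.rise a b u (M a b) := by
      intro a b hab hu hw
      have h0 := hyp.ne_zero a b
      refine ⟨_, by split_ifs <;> simp, rfl, ?_⟩
      obtain ⟨k, hk⟩ := Nat.exists_eq_succ_of_ne_zero h0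
      have h1 := path a b hab hu hw k (by omega)
      have h2 : w * cs.simple (if Even k then a else b) = u * cs.alt a b k := by
        rw [hw, hk, Nat.succ_eq_add_one, mul_assoc, cs.alt_succ_mul]
      rw [hk, Nat.succ_sub_one, h2, h1, Nat.succ_eq_add_one, cs.rise_succ, add_assoc]
    -- The last letters `c`, `d` of the two spellings of `w` are `i` and `j` in an order fixed by
    -- the parity of `M i j`.
    obtain ⟨c, hc, hc', hcl⟩ := last i j hij hu hw'
    obtain ⟨d, hd, hd', hdl⟩ := last j i hij.symm hu.symm
      (by rw [hw', cs.alt_braid, hs])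
    rw [hs] at hdl hd'
    rw [← hyp.rise_longest cs hij hu, ← hcl] at hdl
    by_cases hev : Even (M i j - 1)
    · rw [if_pos hev] at hc' hd'
      subst hc' hd'
      exact hdl
    · rw [if_neg hev] at hc' hd'
      subst hc' hd'
      exact hdl.symm

theorem level_mul_simple {w : W} {i : Fin 3} (h : ¬cs.IsRightDescent w i) :
    cs.level (w * cs.simple i) = cs.level w + cs.step i w := by
  rw [hyp.level_mul_simple_aux cs _ _ i le_rfl (cs.isRightDescent_mul_simple h),
    cs.simple_mul_simple_cancel_right]

theorem level_mul_simple_of_ne {i : Fin 3} (hi : i ≠ 0) (w : W) :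
    cs.level (w * cs.simple i) = cs.level w := by
  by_cases h : cs.IsRightDescent w i
  · rw [hyp.level_mul_simple_aux cs _ w i le_rfl h, cs.step_of_ne hi, add_zero]
  · rw [hyp.level_mul_simple cs h, cs.step_of_ne hi, add_zero]

theorem level_mul_alt {i j : Fin 3} (hij : i ≠ j) {u : W} (hu : cs.IsMinimal i j u) {k : ℕ}
    (hk : k ≤ M i j) : cs.level (u * cs.alt i j k) = cs.level u + cs.rise i j u k := by
  induction k with
  | zero => simp [CoxeterSystem.rise]
  | succ k ih =>
    rw [cs.alt_succ, ← mul_assoc, hyp.level_mul_simple cs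
      (cs.not_isRightDescent_mul_alt hyp.ne_zero hij hu hk), ih (by omega), cs.rise_succ, add_assoc]

theorem level_right {u : W} (hu : cs.IsMinimal 0 1 u) {k : ℕ} (hk : k ≤ M 0 1) :
    cs.level (u * cs.alt 1 0 k) = cs.level u + k / 2 := by
  rw [hyp.level_mul_alt cs (by decide) hu.symm (by rwa [M.symmetric 1 0]), hyp.rise_right cs hu hk]

theorem level_left {u : W} (hu : cs.IsMinimal 0 1 u) {k : ℕ} (hk : k + 2 ≤ M 0 1) :
    cs.level (u * cs.alt 0 1 (k + 1)) = cs.level u + cs.step 0 u + k / 2 := by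
  rw [hyp.level_mul_alt cs (by decide) hu (by omega), hyp.rise_left cs hu hk, add_assoc]

end CoxeterMatrix.IsHyperbolic

/-! ### Levels are distances -/

namespace CoxeterMatrix.IsHyperbolic

variable {W : Type*} [Group W] {M : CoxeterMatrix (Fin 3)} (hyp : M.IsHyperbolic)
  (cs : CoxeterSystem M W)

include hyp

theorem level_mul_of_mem {x : W} (hx : x ∈ Subgroup.closure {cs.simple 1, cs.simple 2}) (w : W) :
    cs.level (w * x) = cs.level w := by
  induction hx using Subgroup.closure_induction_right with
  | one => simp
  | mul_right x _ y hy ih =>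
    rw [← mul_assoc]
    rcases hy with rfl | rfl <;> rw [hyp.level_mul_simple_of_ne cs (by decide), ih]
  | mul_inv_cancel x _ y hy ih =>
    rw [← mul_assoc]
    rcases hy with rfl | rfl <;>
      rw [cs.inv_simple, hyp.level_mul_simple_of_ne cs (by decide), ih]

theorem level_mul_simple_zero_le (w : W) : cs.level (w * cs.simple 0) ≤ cs.level w + 1 := by
  by_cases h : cs.IsRightDescent w 0
  · have := hyp.level_mul_simple_aux cs _ w 0 le_rfl h
    omega
  · rw [hyp.level_mul_simple cs h]
    have := cs.step_le_one 0 w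
    omega

/-- Every vertex other than the base vertex has a neighbour closer to the base vertex. -/
theorem exists_level_add_one_eq_of_isMinimal {u : W} (hu : cs.IsMinimal 1 2 u) (h1 : u ≠ 1) :
    ∃ x ∈ Subgroup.closure {cs.simple 1, cs.simple 2},
      cs.level (u * x * cs.simple 0) + 1 = cs.level u := by
  obtain ⟨i, hi⟩ := cs.exists_rightDescent_of_ne_one h1
  have hi0 : i = 0 := by
    have hu1 := hu.1
    have hu2 := hu.2
    fin_cases i
    exacts [rfl, absurd hi hu1, absurd hi hu2]
  subst hi0
  have hl := hyp.level_mul_simple_aux cs _ u 0 le_rfl hi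
  by_cases hh : cs.IsHorizontal (u * cs.simple 0)
  -- The edge below `u` is the top of an odd face, so crossing it gains nothing. From its upper end
  -- `v * alt 0 1 (M 0 1)`, turning by `s 1` and crossing the next edge leads down the right side of
  -- that face, where edges are not horizontal.
  · have key : ∀ v w, cs.IsMinimal 0 1 v → Odd (M 0 1) → w ∈ Subgroup.closure
        {cs.simple 1, cs.simple 2} → u * w = v * cs.alt 0 1 (M 0 1) →
        ∃ x ∈ Subgroup.closure {cs.simple 1, cs.simple 2},
          cs.level (u * x * cs.simple 0) + 1 = cs.level u := by
      intro v w hv hodd hw he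
      have hm := hyp.three_le_face
      obtain ⟨r, hr⟩ := hodd
      have ev : Even (M 0 1 - 1) := ⟨r, by omega⟩
      have ev' : ¬Even (M 0 1 - 2) := by
        rw [Nat.not_even_iff_odd]
        exact ⟨r - 1, by omega⟩
      refine ⟨w * cs.simple 1, mul_mem hw (Subgroup.subset_closure (by simp)), ?_⟩
      have e1 : u * (w * cs.simple 1) * cs.simple 0 = v * cs.alt 1 0 (M 0 1 - 2) := by
        have a1 := cs.alt_succ_mul 1 0 (M 0 1 - 1)
        have a2 := cs.alt_succ_mul 1 0 (M 0 1 - 2)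
        rw [if_pos ev, show M 0 1 - 1 + 1 = M 0 1 by omega] at a1
        rw [if_neg ev', show M 0 1 - 2 + 1 = M 0 1 - 1 by omega] at a2
        rw [← mul_assoc, he, cs.alt_braid, mul_assoc v, a1, mul_assoc v, a2]
      rw [e1, hyp.level_right cs hv (by omega), ← hyp.level_mul_of_mem cs hw u, he, cs.alt_braid, hyp.level_right cs hv le_rfl]
      omega
    rw [hyp.isHorizontal_iff] at hh
    obtain ⟨hodd, v, hv, h | h, -⟩ := hh
    all_goals
      have hm := hyp.three_le_face
      have ev : Even (M 0 1 - 1) := Nat.Odd.sub_odd hodd odd_one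
      have e : v * cs.alt 0 1 (M 0 1) = v * cs.alt 0 1 (M 0 1 - 1) * cs.simple 0 := by
        conv_lhs => rw [show M 0 1 = M 0 1 - 1 + 1 by omega]
        rw [cs.alt_succ, if_pos ev, mul_assoc]
    · refine key v 1 hv hodd (one_mem _) ?_
      rw [e, ← h, cs.simple_mul_simple_cancel_right, mul_one]
    · refine key v (cs.simple 2) hv hodd (Subgroup.subset_closure (by simp)) ?_
      rw [e, ← h, mul_assoc u, hyp.simple_zero_mul_simple_two, ← mul_assoc u,
        cs.simple_mul_simple_cancel_right]
  · refine ⟨1, one_mem _, ?_⟩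
    rw [mul_one, hl, cs.step_zero hh]

theorem exists_isMinimal_mul_mem (w : W) {i j : Fin 3} :
    ∃ u, cs.IsMinimal i j u ∧ ∃ x ∈ Subgroup.closure {cs.simple i, cs.simple j}, w = u * x := by
  obtain ⟨u, hu, ⟨k, _, h⟩ | ⟨k, _, h⟩⟩ := cs.exists_isMinimal_mul_alt hyp.ne_zero w i j
  · exact ⟨u, hu, _, cs.alt_mem_closure_pair i j k, h⟩
  · exact ⟨u, hu, _, cs.alt_mem_closure_pair' i j (k + 1), h⟩

theorem level_eq_zero_iff {w : W} :
    cs.level w = 0 ↔ w ∈ Subgroup.closure {cs.simple 1, cs.simple 2} := by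
  constructor
  · intro h
    obtain ⟨u, hu, x, hx, rfl⟩ := hyp.exists_isMinimal_mul_mem cs w (i := 1) (j := 2)
    rw [hyp.level_mul_of_mem cs hx] at h
    by_cases h1 : u = 1
    · rwa [h1, one_mul]
    · obtain ⟨y, _, h'⟩ := hyp.exists_level_add_one_eq_of_isMinimal cs hu h1
      omega
  · intro h
    have := hyp.level_mul_of_mem cs h 1
    rwa [one_mul, cs.level_one] at this

theorem exists_level_add_one_eq {w : W} (h : cs.level w ≠ 0) :
    ∃ x ∈ Subgroup.closure {cs.simple 1, cs.simple 2},
      cs.level (w * x * cs.simple 0) + 1 = cs.level w := by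
  obtain ⟨u, hu, x, hx, rfl⟩ := hyp.exists_isMinimal_mul_mem cs w (i := 1) (j := 2)
  rw [hyp.level_mul_of_mem cs hx] at h ⊢
  have h1 : u ≠ 1 := by
    rintro rfl
    simp at h
  obtain ⟨y, hy, h'⟩ := hyp.exists_level_add_one_eq_of_isMinimal cs hu h1
  refine ⟨x⁻¹ * y, mul_mem (inv_mem hx) hy, ?_⟩
  rwa [mul_assoc u, mul_inv_cancel_left]

theorem finite_closure_pair (i j : Fin 3) :
    (Subgroup.closure {cs.simple i, cs.simple j} : Set W).Finite := by
  refine Set.Finite.subset (((Set.finite_Iic (M i j)).image (cs.alt i j)).union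
    ((Set.finite_Iic (M i j)).image (cs.alt j i))) fun x hx => ?_
  obtain ⟨k, hk, h | h⟩ := cs.mem_closure_pair hyp.ne_zero hx
  exacts [Or.inl ⟨k, hk, h.symm⟩, Or.inr ⟨k, hk, h.symm⟩]

/-- A chamber of level `n + 1` arises from one of level `n` by crossing an edge and turning about a
vertex, and vertex stabilizers are finite. -/
theorem finite_level_eq (n : ℕ) : {w | cs.level w = n}.Finite := by
  have hfin := hyp.finite_closure_pair cs 1 2
  induction n with
  | zero =>
    simp only [hyp.level_eq_zero_iff]
    exact hfin
  | succ n ih =>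
    refine (Set.Finite.image2 (fun w x => w * cs.simple 0 * x) ih hfin).subset fun w hw => ?_
    rw [Set.mem_ofPred_eq] at hw
    obtain ⟨x, hx, h⟩ := hyp.exists_level_add_one_eq cs (w := w) (by omega)
    refine ⟨w * x * cs.simple 0, ?_, x⁻¹, inv_mem hx, ?_⟩
    · rw [Set.mem_ofPred_eq]
      omega
    · simp

end CoxeterMatrix.IsHyperbolic

/-! ### Graph distance as the level of a translated chamber -/

section Graph

variable {ℓ m : ℕ} {hℓ : 3 ≤ ℓ} {hm : 3 ≤ m}

local notation "csys" => CoxeterMatrix.toCoxeterSystem (tessellationMatrix ℓ m hℓ hm)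

theorem tessellationMatrix_isHyperbolic (hyp : 4 < (ℓ - 2) * (m - 2)) :
    (tessellationMatrix ℓ m hℓ hm).IsHyperbolic where
  three_le_face := hm
  three_le_vertex := hℓ
  edge := rfl
  hyperbolic := hyp

theorem cellStabilizer_zero : cellStabilizer ℓ m hℓ hm 0 =
    Subgroup.closure {(csys).simple 1, (csys).simple 2} := by
  rw [cellStabilizer]
  congr 1
  ext g
  simp only [Set.mem_ofPred_eq, Fin.exists_fin_succ, Set.mem_insert_iff, Set.mem_singleton_iff,
    CoxeterMatrix.toCoxeterSystem_simple]
  simp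

theorem cellStabilizer_one : cellStabilizer ℓ m hℓ hm 1 =
    Subgroup.closure {(csys).simple 0, (csys).simple 2} := by
  rw [cellStabilizer]
  congr 1
  ext g
  simp only [Set.mem_ofPred_eq, Fin.exists_fin_succ, Set.mem_insert_iff, Set.mem_singleton_iff,
    CoxeterMatrix.toCoxeterSystem_simple]
  simp

theorem mk_eq_mk_iff {w w' : TessellationGroup ℓ m hℓ hm} :
    (QuotientGroup.mk w : TessellationCell ℓ m hℓ hm 0) = QuotientGroup.mk w' ↔
      w⁻¹ * w' ∈ Subgroup.closure {(csys).simple 1, (csys).simple 2} := by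
  rw [QuotientGroup.eq, cellStabilizer_zero]

theorem mk_mul_of_mem {x : TessellationGroup ℓ m hℓ hm}
    (hx : x ∈ Subgroup.closure {(csys).simple 1, (csys).simple 2})
    (w : TessellationGroup ℓ m hℓ hm) :
    (QuotientGroup.mk (w * x) : TessellationCell ℓ m hℓ hm 0) = QuotientGroup.mk w := by
  symm
  rwa [mk_eq_mk_iff, inv_mul_cancel_left]

theorem tessellationGraph_adj_iff (hyp : 4 < (ℓ - 2) * (m - 2))
    {w : TessellationGroup ℓ m hℓ hm} {v : TessellationCell ℓ m hℓ hm 0} :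
    (tessellationGraph ℓ m hℓ hm).Adj (QuotientGroup.mk w) v ↔
      QuotientGroup.mk w ≠ v ∧ ∃ x ∈ Subgroup.closure {(csys).simple 1, (csys).simple 2},
        v = QuotientGroup.mk (w * x * (csys).simple 0) := by
  have hne := (tessellationMatrix_isHyperbolic (hℓ := hℓ) (hm := hm) hyp)
  refine and_congr_right fun hv => ?_
  constructor
  · rintro ⟨e, ⟨g, hg, rfl⟩, g', rfl, he⟩
    refine ⟨w⁻¹ * g, mk_eq_mk_iff.1 hg.symm, ?_⟩
    rw [mul_inv_cancel_left]
    have he' := he.symm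
    rw [QuotientGroup.eq, cellStabilizer_one] at he'
    obtain ⟨k, hk, h⟩ := (csys).mem_closure_pair hne.ne_zero he'
    have hs2 : (csys).simple 2 ∈ Subgroup.closure {(csys).simple 1, (csys).simple 2} :=
      Subgroup.subset_closure (by simp)
    have h02 := hne.simple_zero_mul_simple_two (csys)
    rw [hne.edge] at hk
    rw [inv_mul_eq_iff_eq_mul, inv_mul_eq_iff_eq_mul] at h
    have hc : g' = g ∨ g' = g * (csys).simple 0 ∨ g' = g * (csys).simple 2 ∨
        g' = g * (csys).simple 0 * (csys).simple 2 := by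
      interval_cases k
      · simp only [CoxeterSystem.alt_zero, mul_one, or_self] at h
        exact Or.inl h
      · simp only [CoxeterSystem.alt_one] at h
        tauto
      · simp only [CoxeterSystem.alt_two, ← h02, ← mul_assoc, or_self] at h
        tauto
    -- The four chambers around an edge: two lie at the given vertex and two at its neighbour.
    rcases hc with rfl | rfl | rfl | rfl
    · exact absurd hg.symm hv
    · rfl
    · rw [mk_mul_of_mem hs2] at hv
      exact absurd hg.symm hv
    · exact mk_mul_of_mem hs2 _
  · rintro ⟨x, hx, rfl⟩
    refine ⟨QuotientGroup.mk (w * x), ⟨w * x, mk_mul_of_mem hx w, rfl⟩,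
      w * x * (csys).simple 0, rfl, ?_⟩
    symm
    rw [QuotientGroup.eq, cellStabilizer_one, inv_mul_cancel_left]
    exact Subgroup.subset_closure (by simp)

/-- Level is constant on vertex cosets and grows by at most one along an edge. Translation by `g⁻¹`
makes an arbitrary vertex the base vertex. -/
theorem level_le_of_walk (hyp : 4 < (ℓ - 2) * (m - 2)) (g : TessellationGroup ℓ m hℓ hm)
    {u v : TessellationCell ℓ m hℓ hm 0} (p : (tessellationGraph ℓ m hℓ hm).Walk u v) :
    ∀ w w' : TessellationGroup ℓ m hℓ hm, QuotientGroup.mk w = u → QuotientGroup.mk w' = v →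
      (csys).level (g⁻¹ * w') ≤ (csys).level (g⁻¹ * w) + p.length := by
  have hH := (tessellationMatrix_isHyperbolic (hℓ := hℓ) (hm := hm) hyp)
  have hcongr : ∀ w w' : TessellationGroup ℓ m hℓ hm,
      (QuotientGroup.mk w : TessellationCell ℓ m hℓ hm 0) = QuotientGroup.mk w' →
      (csys).level (g⁻¹ * w') = (csys).level (g⁻¹ * w) := by
    intro w w' h
    rw [mk_eq_mk_iff] at h
    rw [← hH.level_mul_of_mem (csys) h (g⁻¹ * w), mul_assoc, mul_inv_cancel_left]
  induction p with
  | nil =>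
    rintro w w' rfl h
    exact (hcongr w w' h.symm).le
  | cons hadj p ih =>
    rintro w w' rfl rfl
    obtain ⟨_, x, hx, rfl⟩ := (tessellationGraph_adj_iff hyp).1 hadj
    have h1 := ih _ w' rfl rfl
    have h2 := hH.level_mul_simple_zero_le (csys) (g⁻¹ * (w * x))
    rw [← mul_assoc g⁻¹ w, hH.level_mul_of_mem (csys) hx, mul_assoc, mul_assoc, ← mul_assoc w] at h2
    rw [SimpleGraph.Walk.length_cons]
    omega

theorem exists_walk_length_eq_level (hyp : 4 < (ℓ - 2) * (m - 2))
    (g : TessellationGroup ℓ m hℓ hm) (n : ℕ) : ∀ w : TessellationGroup ℓ m hℓ hm,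
    (csys).level (g⁻¹ * w) = n →
    ∃ p : (tessellationGraph ℓ m hℓ hm).Walk (QuotientGroup.mk w) (QuotientGroup.mk g),
      p.length = n := by
  have hH := (tessellationMatrix_isHyperbolic (hℓ := hℓ) (hm := hm) hyp)
  induction n with
  | zero =>
    intro w hw
    rw [hH.level_eq_zero_iff, ← mk_eq_mk_iff] at hw
    rw [hw]
    exact ⟨.nil, rfl⟩
  | succ n ih =>
    intro w hw
    obtain ⟨x, hx, h⟩ := hH.exists_level_add_one_eq (csys) (w := g⁻¹ * w) (by omega)
    rw [mul_assoc g⁻¹, mul_assoc g⁻¹] at h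
    obtain ⟨p, hp⟩ := ih (w * x * (csys).simple 0) (by omega)
    have hadj : (tessellationGraph ℓ m hℓ hm).Adj (QuotientGroup.mk w)
        (QuotientGroup.mk (w * x * (csys).simple 0)) := by
      refine (tessellationGraph_adj_iff hyp).2 ⟨fun he => ?_, x, hx, rfl⟩
      have := level_le_of_walk hyp g (.nil' (QuotientGroup.mk w)) (w * x * (csys).simple 0) w
        he.symm rfl
      rw [SimpleGraph.Walk.length_nil] at this
      omega
    exact ⟨.cons hadj p, by rw [SimpleGraph.Walk.length_cons, hp]⟩

theorem tessellationGraph_edist (hyp : 4 < (ℓ - 2) * (m - 2)) (g w : TessellationGroup ℓ m hℓ hm) :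
    (tessellationGraph ℓ m hℓ hm).edist (QuotientGroup.mk g) (QuotientGroup.mk w) =
      (csys).level (g⁻¹ * w) := by
  obtain ⟨p, hp⟩ := exists_walk_length_eq_level hyp g _ w rfl
  apply le_antisymm
  · rw [SimpleGraph.edist_comm, ← hp]
    exact SimpleGraph.edist_le p
  · have hr : (tessellationGraph ℓ m hℓ hm).Reachable (QuotientGroup.mk g) (QuotientGroup.mk w) :=
      ⟨p.reverse⟩
    obtain ⟨q, hq⟩ := hr.exists_walk_length_eq_edist
    rw [← hq]
    have := level_le_of_walk hyp g q g w rfl rfl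
    rw [inv_mul_cancel, CoxeterSystem.level_one, zero_add] at this
    exact_mod_cast this

theorem tessellationGraph_connected (hyp : 4 < (ℓ - 2) * (m - 2)) :
    (tessellationGraph ℓ m hℓ hm).Connected := by
  have : Nonempty (TessellationCell ℓ m hℓ hm 0) := ⟨QuotientGroup.mk 1⟩
  refine ⟨fun u v => ?_⟩
  induction u using QuotientGroup.induction_on with | _ g => ?_
  induction v using QuotientGroup.induction_on with | _ w => ?_
  obtain ⟨p, -⟩ := exists_walk_length_eq_level hyp g _ w rfl
  exact ⟨p.reverse⟩

theorem graphSphere_eq_image (hyp : 4 < (ℓ - 2) * (m - 2)) (g : TessellationGroup ℓ m hℓ hm)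
    (n : ℕ) : graphSphere (tessellationGraph ℓ m hℓ hm) (QuotientGroup.mk g) n =
      (fun u => (QuotientGroup.mk (g * u) : TessellationCell ℓ m hℓ hm 0)) ''
        {u | (csys).IsMinimal 1 2 u ∧ (csys).level u = n} := by
  have hH := (tessellationMatrix_isHyperbolic (hℓ := hℓ) (hm := hm) hyp)
  ext v
  induction v using QuotientGroup.induction_on with | _ w => ?_
  rw [graphSphere, Set.mem_ofPred_eq, tessellationGraph_edist hyp, Nat.cast_inj]
  constructor
  · intro h
    obtain ⟨u, hu, x, hx, hw⟩ := hH.exists_isMinimal_mul_mem (csys) (g⁻¹ * w) (i := 1) (j := 2)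
    refine ⟨u, ⟨hu, ?_⟩, ?_⟩
    · rwa [hw, hH.level_mul_of_mem (csys) hx] at h
    · rw [inv_mul_eq_iff_eq_mul] at hw
      rw [hw, ← mul_assoc, mk_mul_of_mem hx]
  · rintro ⟨u, ⟨hu, hn⟩, he⟩
    rw [mk_eq_mk_iff] at he
    rw [← hn, ← hH.level_mul_of_mem (csys) he u, mul_inv_rev, mul_assoc, mul_inv_cancel_left]

theorem graphSphere_finite (hyp : 4 < (ℓ - 2) * (m - 2)) (o : TessellationCell ℓ m hℓ hm 0)
    (n : ℕ) : (graphSphere (tessellationGraph ℓ m hℓ hm) o n).Finite := by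
  induction o using QuotientGroup.induction_on with | _ g => ?_
  rw [graphSphere_eq_image hyp]
  exact (((tessellationMatrix_isHyperbolic hyp).finite_level_eq (csys) n).subset
    fun u hu => hu.2).image _

theorem graphSphere_ncard (hyp : 4 < (ℓ - 2) * (m - 2)) (o : TessellationCell ℓ m hℓ hm 0)
    (n : ℕ) : (graphSphere (tessellationGraph ℓ m hℓ hm) o n).ncard =
      {u | (csys).IsMinimal 1 2 u ∧ (csys).level u = n}.ncard := by
  have hH := (tessellationMatrix_isHyperbolic (hℓ := hℓ) (hm := hm) hyp)
  induction o using QuotientGroup.induction_on with | _ g => ?_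
  rw [graphSphere_eq_image hyp, Set.InjOn.ncard_image]
  rintro u ⟨hu, -⟩ u' ⟨hu', -⟩ he
  refine hu.eq_of_mem_closure hH.ne_zero (by decide) hu' ?_
  have he' := mk_eq_mk_iff.1 he
  rwa [mul_inv_rev, mul_assoc, inv_mul_cancel_left] at he'

end Graph
open scoped PowerSeries

/-! ### Generating functions of weighted sets -/

section WeightSeries

variable {α : Type*} (L : α → ℕ)

/-- The generating function of the set `S` with respect to the weight `L`. -/
noncomputable def weightSeries (S : Set α) : PowerSeries ℂ :=
  PowerSeries.mk fun n => (({w | w ∈ S ∧ L w = n} : Set α).ncard : ℂ)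

variable {L}

open Classical in
theorem coeff_weightSeries (hL : ∀ n, {w | L w = n}.Finite) (S : Set α) (n : ℕ) :
    PowerSeries.coeff n (weightSeries L S) = ∑ w ∈ (hL n).toFinset, if w ∈ S then (1 : ℂ) else 0 := by
  rw [weightSeries, PowerSeries.coeff_mk, ← Finset.sum_filter, Finset.sum_const, nsmul_one,
    ← Set.ncard_coe_finset]
  congr 2
  ext w
  simp [and_comm]

theorem weightSeries_add_of_disjoint (hL : ∀ n, {w | L w = n}.Finite) {S T U : Set α}
    (hd : Disjoint S T) (hU : ∀ w, w ∈ U ↔ w ∈ S ∨ w ∈ T) :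
    weightSeries L U = weightSeries L S + weightSeries L T := by
  classical
  ext n
  rw [map_add, coeff_weightSeries hL, coeff_weightSeries hL, coeff_weightSeries hL,
    ← Finset.sum_add_distrib]
  refine Finset.sum_congr rfl fun w hwn => ?_
  clear hwn
  have hST : w ∈ S → w ∉ T := fun h => Set.disjoint_left.1 hd h
  have hw := hU w
  by_cases h1 : w ∈ S <;> by_cases h2 : w ∈ T <;> simp_all

theorem weightSeries_image {β : Type*} {L' : β → ℕ} {S : Set β} {f : β → α} (hf : Set.InjOn f S)
    {k : ℕ} (hk : ∀ w ∈ S, L (f w) = L' w + k) :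
    weightSeries L (f '' S) = PowerSeries.X ^ k * weightSeries L' S := by
  ext n
  rw [PowerSeries.coeff_X_pow_mul']
  simp only [weightSeries, PowerSeries.coeff_mk]
  split_ifs with h
  · congr 1
    rw [← Set.InjOn.ncard_image (f := f) (s := {w | w ∈ S ∧ L' w = n - k}) (hf.mono fun w hw => hw.1)]
    congr 1
    ext w
    constructor
    · rintro ⟨⟨v, hv, rfl⟩, hn⟩
      exact ⟨v, ⟨hv, by have := hk v hv; omega⟩, rfl⟩
    · rintro ⟨v, ⟨hv, hn⟩, rfl⟩
      exact ⟨⟨v, hv, rfl⟩, by have := hk v hv; omega⟩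
  · rw [Nat.cast_eq_zero, show {w | w ∈ f '' S ∧ L w = n} = ∅ from ?_, Set.ncard_empty]
    ext w
    simp only [Set.mem_ofPred_eq, Set.mem_empty_iff_false, iff_false]
    rintro ⟨⟨v, hv, rfl⟩, hn⟩
    have := hk v hv
    omega

theorem weightSeries_mul_right {G : Type*} [Group G] {L : G → ℕ} (g : G) {S : Set G} {k : ℕ}
    (hk : ∀ w ∈ S, L (w * g) = L w + k) :
    weightSeries L ((· * g) '' S) = PowerSeries.X ^ k * weightSeries L S :=
  weightSeries_image (mul_left_injective g).injOn hk

end WeightSeries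

theorem PowerSeries.two_ne_zero : (2 : ℂ⟦X⟧) ≠ 0 := by
  intro h
  have := congrArg PowerSeries.constantCoeff h
  rw [map_ofNat, map_zero] at this
  norm_num at this

theorem sum_range_X_pow_half_succ {R : Type*} [CommRing R] (x : R) (p : ℕ) :
    ∑ k ∈ Finset.range (2 * p), x ^ ((k + 1) / 2) = (1 + x) * ∑ k ∈ Finset.range p, x ^ k := by
  induction p with
  | zero => simp
  | succ p ih =>
    rw [show 2 * (p + 1) = 2 * p + 1 + 1 by ring, Finset.sum_range_succ, Finset.sum_range_succ, ih,
      Finset.sum_range_succ, show (2 * p + 1) / 2 = p by omega,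
      show (2 * p + 1 + 1) / 2 = p + 1 by omega]
    ring

theorem sum_range_X_pow_half_pred {R : Type*} [CommRing R] (x : R) (p : ℕ) :
    ∑ k ∈ Finset.range (2 * p + 1), x ^ ((k - 1) / 2) = 1 + 2 * ∑ k ∈ Finset.range p, x ^ k := by
  induction p with
  | zero => simp
  | succ p ih =>
    rw [show 2 * (p + 1) + 1 = 2 * p + 1 + 1 + 1 by ring, Finset.sum_range_succ,
      Finset.sum_range_succ, ih, Finset.sum_range_succ, show (2 * p + 1 - 1) / 2 = p by omega,
      show (2 * p + 1 + 1 - 1) / 2 = p by omega]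
    ring

/-! ### Linear relations between the series of vertices, edges and faces -/

namespace CoxeterMatrix.IsHyperbolic

variable {W : Type*} [Group W] {M : CoxeterMatrix (Fin 3)} (hyp : M.IsHyperbolic)
  (cs : CoxeterSystem M W)

include hyp

/-- Each element of the dihedral parabolic is listed exactly once: the identity opens the first
family and the longest element closes the second. -/
theorem weightSeries_univ {i j : Fin 3} (hij : i ≠ j) :
    weightSeries cs.level Set.univ =
      ∑ k ∈ Finset.range (M i j),
        weightSeries cs.level ((· * cs.alt i j k) '' {u | cs.IsMinimal i j u}) +
      ∑ k ∈ Finset.range (M i j),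
        weightSeries cs.level ((· * cs.alt j i (k + 1)) '' {u | cs.IsMinimal i j u}) := by
  classical
  have hL := hyp.finite_level_eq cs
  have hs : M j i = M i j := M.symmetric j i
  ext n
  rw [map_add, map_sum, map_sum]
  simp only [coeff_weightSeries hL]
  rw [Finset.sum_comm, Finset.sum_comm (s := Finset.range (M i j)), ← Finset.sum_add_distrib]
  refine Finset.sum_congr rfl fun w _ => ?_
  rw [if_pos (Set.mem_univ w)]
  obtain ⟨u, hu, ⟨k, hk, rfl⟩ | ⟨k, hk, rfl⟩⟩ := cs.exists_isMinimal_mul_alt hyp.ne_zero w i j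
  · rw [Finset.sum_eq_single k, if_pos ⟨u, hu, rfl⟩, Finset.sum_eq_zero, add_zero]
    · intro k' hk'
      rw [if_neg]
      rintro ⟨u', hu', he⟩
      exact cs.mul_alt_ne_mul_alt hyp.ne_zero hij hu hu' hk (Finset.mem_range.1 hk') he.symm
    · intro k' hk' hne
      rw [if_neg]
      rintro ⟨u', hu', he⟩
      exact hne (cs.mul_alt_injective hyp.ne_zero hij hu' hu (Finset.mem_range.1 hk').le hk.le he).2
    · intro h
      exact absurd (Finset.mem_range.2 hk) h
  · rw [Finset.sum_eq_zero, Finset.sum_eq_single k, if_pos ⟨u, hu, rfl⟩, zero_add]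
    · intro k' hk' hne
      rw [if_neg]
      rintro ⟨u', hu', he⟩
      have hk'' := Finset.mem_range.1 hk'
      have := (cs.mul_alt_injective hyp.ne_zero hij.symm (CoxeterSystem.IsMinimal.symm hu') hu.symm
        (by omega) (by omega) he).2
      omega
    · intro h
      exact absurd (Finset.mem_range.2 hk) h
    · intro k' hk'
      rw [if_neg]
      rintro ⟨u', hu', he⟩
      exact cs.mul_alt_ne_mul_alt hyp.ne_zero hij hu' hu (Finset.mem_range.1 hk') hk he

theorem weightSeries_univ_vertex : weightSeries cs.level Set.univ =
    2 * (M 1 2 : ℂ⟦X⟧) * weightSeries cs.level {u | cs.IsMinimal 1 2 u} := by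
  rw [hyp.weightSeries_univ cs (show (1 : Fin 3) ≠ 2 by decide)]
  have h : ∀ g ∈ Subgroup.closure {cs.simple 1, cs.simple 2},
      weightSeries cs.level ((· * g) '' {u | cs.IsMinimal 1 2 u}) =
        weightSeries cs.level {u | cs.IsMinimal 1 2 u} := by
    intro g hg
    rw [weightSeries_mul_right g (k := 0), pow_zero, one_mul]
    intro w _
    rw [hyp.level_mul_of_mem cs hg, add_zero]
  simp only [h _ (cs.alt_mem_closure_pair 1 2 _), h _ (cs.alt_mem_closure_pair' 1 2 _),
    Finset.sum_const, Finset.card_range, nsmul_eq_mul]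
  ring

theorem weightSeries_univ_eq_two_mul {i : Fin 3} (hi : i ≠ 0) : weightSeries cs.level Set.univ =
    2 * weightSeries cs.level {w | ¬cs.IsRightDescent w i} := by
  have h : weightSeries cs.level ((· * cs.simple i) '' {w | ¬cs.IsRightDescent w i}) =
      weightSeries cs.level {w | ¬cs.IsRightDescent w i} := by
    rw [weightSeries_mul_right _ (k := 0), pow_zero, one_mul]
    intro w _
    rw [hyp.level_mul_simple_of_ne cs hi, add_zero]
  rw [two_mul]
  nth_rw 1 [← h]
  refine weightSeries_add_of_disjoint (hyp.finite_level_eq cs) ?_ fun w => ?_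
  · rw [Set.disjoint_left]
    rintro _ ⟨w, hw, rfl⟩ h
    exact h (cs.isRightDescent_mul_simple hw)
  · refine iff_of_true (Set.mem_univ w) ?_
    by_cases hd : cs.IsRightDescent w i
    · exact Or.inl ⟨w * cs.simple i, cs.not_isRightDescent_mul_simple hd,
        cs.simple_mul_simple_cancel_right i⟩
    · exact Or.inr hd

theorem weightSeries_zero_eq_two_mul : weightSeries cs.level {w | ¬cs.IsRightDescent w 0} =
    2 * weightSeries cs.level {w | cs.IsMinimal 0 2 w} := by
  have h : weightSeries cs.level ((· * cs.simple 2) '' {w | cs.IsMinimal 0 2 w}) =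
      weightSeries cs.level {w | cs.IsMinimal 0 2 w} := by
    rw [weightSeries_mul_right _ (k := 0), pow_zero, one_mul]
    intro w _
    rw [hyp.level_mul_simple_of_ne cs (by decide), add_zero]
  rw [two_mul]
  nth_rw 1 [← h]
  refine weightSeries_add_of_disjoint (hyp.finite_level_eq cs) ?_ fun w => ?_
  · rw [Set.disjoint_left]
    rintro _ ⟨w, hw, rfl⟩ h
    exact h.2 (cs.isRightDescent_mul_simple hw.2)
  · constructor
    · intro h0
      by_cases hd : cs.IsRightDescent w 2
      · refine Or.inl ⟨w * cs.simple 2, ⟨?_, cs.not_isRightDescent_mul_simple hd⟩,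
          cs.simple_mul_simple_cancel_right 2⟩
        rwa [hyp.isRightDescent_mul_simple_two]
      · exact Or.inr ⟨h0, hd⟩
    · rintro (⟨v, hv, rfl⟩ | hw)
      · exact (hyp.isRightDescent_mul_simple_two cs v).not.2 hv.1
      · exact hw.1

/-- The Euler characteristic of the tessellated plane, weighted by the distance to the base
vertex. -/
theorem weightSeries_euler :
    weightSeries cs.level {w | cs.IsMinimal 1 2 w} - weightSeries cs.level {w | cs.IsMinimal 0 2 w} +
      weightSeries cs.level {w | cs.IsMinimal 0 1 w} = 1 := by
  classical
  have hL := hyp.finite_level_eq cs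
  have h1 := hyp.weightSeries_univ_eq_two_mul cs (i := 1) (by decide)
  have h2 := hyp.weightSeries_univ_eq_two_mul cs (i := 2) (by decide)
  have h0 := hyp.weightSeries_zero_eq_two_mul cs
  have hone : weightSeries cs.level {1} = 1 := by
    ext n
    rw [PowerSeries.coeff_one, weightSeries, PowerSeries.coeff_mk]
    split_ifs with hn
    · rw [hn, show {w | w ∈ ({1} : Set W) ∧ cs.level w = 0} = {1} from ?_, Set.ncard_singleton,
        Nat.cast_one]
      ext w
      constructor
      · exact fun h => h.1
      · rintro rfl
        exact ⟨rfl, cs.level_one⟩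
    · rw [show {w | w ∈ ({1} : Set W) ∧ cs.level w = n} = ∅ from ?_, Set.ncard_empty, Nat.cast_zero]
      ext w
      simp only [Set.mem_ofPred_eq, Set.mem_singleton_iff, Set.mem_empty_iff_false, iff_false]
      rintro ⟨rfl, h⟩
      exact hn (h.symm.trans cs.level_one)
  -- Inclusion-exclusion: each `w` contributes the product over `i` of `1 - [i is not a descent]`,
  -- which is zero because no `w` has all three descents.
  have hie : weightSeries cs.level Set.univ - weightSeries cs.level {w | ¬cs.IsRightDescent w 0} -
      weightSeries cs.level {w | ¬cs.IsRightDescent w 1} -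
      weightSeries cs.level {w | ¬cs.IsRightDescent w 2} +
      weightSeries cs.level {w | cs.IsMinimal 1 2 w} +
      weightSeries cs.level {w | cs.IsMinimal 0 2 w} +
      weightSeries cs.level {w | cs.IsMinimal 0 1 w} - weightSeries cs.level {1} = 0 := by
    ext n
    simp only [map_sub, map_add, coeff_weightSeries hL, map_zero]
    simp only [← Finset.sum_sub_distrib, ← Finset.sum_add_distrib]
    refine Finset.sum_eq_zero fun w _ => ?_
    have hall := hyp.not_isRightDescent_all cs (w := w)
    have hw1 : w ∈ ({1} : Set W) ↔ ¬cs.IsRightDescent w 0 ∧ ¬cs.IsRightDescent w 1 ∧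
        ¬cs.IsRightDescent w 2 := by
      constructor
      · rintro rfl
        exact ⟨cs.not_isRightDescent_one _, cs.not_isRightDescent_one _,
          cs.not_isRightDescent_one _⟩
      · rintro ⟨h0, h1, h2⟩
        by_contra hne
        obtain ⟨i, hi⟩ := cs.exists_rightDescent_of_ne_one hne
        fin_cases i <;> contradiction
    simp only [Set.mem_univ, if_true, Set.mem_ofPred_eq, CoxeterSystem.IsMinimal, hw1]
    by_cases d0 : cs.IsRightDescent w 0 <;> by_cases d1 : cs.IsRightDescent w 1 <;>
      by_cases d2 : cs.IsRightDescent w 2 <;> simp_all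
  rw [hone] at hie
  have h12 := mul_left_cancel₀ PowerSeries.two_ne_zero (h1.symm.trans h2)
  linear_combination hie + h0 - h1 - h12

theorem weightSeries_edges {S : Set W} (hS : ∀ w ∈ S, cs.IsMinimal 0 2 w) {d : ℕ}
    (hd : ∀ w ∈ S, cs.step 0 w = d) :
    ∑ k ∈ Finset.range (M 0 2), weightSeries cs.level ((· * cs.alt 0 2 k) '' S) +
      ∑ k ∈ Finset.range (M 0 2), weightSeries cs.level ((· * cs.alt 2 0 (k + 1)) '' S) =
    2 * (1 + PowerSeries.X ^ d) * weightSeries cs.level S := by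
  have h2 : ∀ w, cs.level (w * cs.simple 2) = cs.level w :=
    hyp.level_mul_simple_of_ne cs (by decide)
  have h0 : ∀ w ∈ S, cs.level (w * cs.simple 0) = cs.level w + d := by
    intro w hw
    rw [hyp.level_mul_simple cs (hS w hw).1, hd w hw]
  have e1 := weightSeries_mul_right (L := cs.level) (cs.alt 0 2 0) (S := S) (k := 0)
    (by simp)
  have e2 := weightSeries_mul_right (L := cs.level) (cs.alt 0 2 1) (S := S) (k := d)
    (by simpa only [cs.alt_one] using h0)
  have e3 := weightSeries_mul_right (L := cs.level) (cs.alt 2 0 1) (S := S) (k := 0)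
    (by intro w _; rw [cs.alt_one, h2, add_zero])
  have e4 := weightSeries_mul_right (L := cs.level) (cs.alt 2 0 2) (S := S) (k := d)
    (by
      intro w hw
      rw [cs.alt_two, ← hyp.simple_zero_mul_simple_two, ← mul_assoc, h2, h0 w hw])
  rw [hyp.edge]
  simp only [Finset.sum_range_succ, Finset.range_zero, Finset.sum_empty, zero_add, one_add_one_eq_two]
  rw [e1, e2, e3, e4]
  ring

theorem not_isHorizontal_of_even (heven : Even (M 0 1)) (w : W) : ¬cs.IsHorizontal w := by
  rw [hyp.isHorizontal_iff]
  exact fun h => (Nat.not_even_iff_odd.2 h.1) heven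

/-- The growth series of the tessellation by faces of even length. -/
theorem weightSeries_of_even {p : ℕ} (hp : M 0 1 = 2 * p) :
    ((1 + PowerSeries.X - (M 1 2 : ℂ⟦X⟧)) * ∑ k ∈ Finset.range p, (PowerSeries.X : ℂ⟦X⟧) ^ k +
      (M 1 2 : ℂ⟦X⟧)) * weightSeries cs.level {w | cs.IsMinimal 1 2 w} =
    (1 + PowerSeries.X) * ∑ k ∈ Finset.range p, (PowerSeries.X : ℂ⟦X⟧) ^ k := by
  have heven : Even (M 0 1) := ⟨p, by omega⟩
  have hA := hyp.weightSeries_univ_vertex cs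
  have hE := hyp.weightSeries_euler cs
  have hG := hyp.weightSeries_univ cs (show (0 : Fin 3) ≠ 2 by decide)
  rw [hyp.weightSeries_edges cs (d := 1) (S := {w | cs.IsMinimal 0 2 w}) (fun w hw => hw)
    fun w _ => cs.step_zero (hyp.not_isHorizontal_of_even cs heven w), hA] at hG
  have hH := hyp.weightSeries_univ cs (show (0 : Fin 3) ≠ 1 by decide)
  have e1 : ∀ k ∈ Finset.range (M 0 1),
      weightSeries cs.level ((· * cs.alt 0 1 k) '' {u | cs.IsMinimal 0 1 u}) =
        PowerSeries.X ^ ((k + 1) / 2) * weightSeries cs.level {u | cs.IsMinimal 0 1 u} := by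
    intro k hk
    refine weightSeries_mul_right _ fun w hw => ?_
    rw [hyp.level_mul_alt cs (by decide) hw (Finset.mem_range.1 hk).le, rise_left_of_even cs heven]
  have e2 : ∀ k ∈ Finset.range (M 0 1),
      weightSeries cs.level ((· * cs.alt 1 0 (k + 1)) '' {u | cs.IsMinimal 0 1 u}) =
        PowerSeries.X ^ ((k + 1) / 2) * weightSeries cs.level {u | cs.IsMinimal 0 1 u} := by
    intro k hk
    exact weightSeries_mul_right _ fun w hw => hyp.level_right cs hw (Finset.mem_range.1 hk)
  rw [Finset.sum_congr rfl e1, Finset.sum_congr rfl e2, ← Finset.sum_mul, hp,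
    sum_range_X_pow_half_succ, hA] at hH
  have hG' := mul_left_cancel₀ PowerSeries.two_ne_zero ((mul_assoc _ _ _).symm.trans
    (hG.trans (mul_assoc _ _ _)))
  have hH' := mul_left_cancel₀ PowerSeries.two_ne_zero ((mul_assoc _ _ _).symm.trans
    (hH.trans (two_mul _).symm))
  set P := ∑ k ∈ Finset.range p, (PowerSeries.X : ℂ⟦X⟧) ^ k
  -- With `ℓ F = (1 + X) G = (1 + X) P H`, multiplying the Euler relation by `(1 + X) P` leaves only
  -- `F`.
  linear_combination (1 + PowerSeries.X) * P * hE - P * hG' + hH'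

/-- A horizontal edge is the top of a unique face with nonhorizontal bottom edge, `p` levels above
its lowest vertex. -/
theorem weightSeries_horizontal_edges {p : ℕ} (hp : M 0 1 = 2 * p + 1) :
    weightSeries cs.level {w | cs.IsMinimal 0 2 w ∧ cs.IsHorizontal w} =
      PowerSeries.X ^ p * weightSeries cs.level {w | cs.IsMinimal 0 1 w ∧ ¬cs.IsHorizontal w} := by
  have hodd : Odd (M 0 1) := ⟨p, hp⟩
  have hm := hyp.three_le_face
  rw [← weightSeries_mul_right (cs.alt 0 1 (M 0 1 - 1))]
  · congr 1
    ext w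
    constructor
    · rintro ⟨hw, hh⟩
      rw [hyp.isHorizontal_iff] at hh
      obtain ⟨_, u, hu, h | h, hn⟩ := hh
      · exact ⟨u, ⟨hu, hn⟩, h.symm⟩
      · have := (hyp.descents_top cs hodd hu).1.2
        rw [← h] at this
        exact absurd (cs.isRightDescent_mul_simple hw.2) this
    · rintro ⟨u, ⟨hu, hn⟩, rfl⟩
      exact ⟨(hyp.descents_top cs hodd hu).1, (hyp.isHorizontal_top cs hodd hu).2 hn⟩
  · rintro w ⟨hw, hn⟩
    have := hyp.level_left cs hw (k := M 0 1 - 2) (by omega)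
    rw [show M 0 1 - 2 + 1 = M 0 1 - 1 by omega, cs.step_zero hn] at this
    rw [this]
    omega

/-- A horizontal edge is the top of the face on one side and the bottom of the face on the other;
crossing it by `s 2` passes between their chambers. -/
theorem weightSeries_horizontal_faces :
    weightSeries cs.level {w | cs.IsMinimal 0 1 w ∧ cs.IsHorizontal w} =
      weightSeries cs.level {w | cs.IsMinimal 0 2 w ∧ cs.IsHorizontal w} := by
  rw [← one_mul (weightSeries cs.level {w | cs.IsMinimal 0 2 w ∧ cs.IsHorizontal w}),
    ← pow_zero PowerSeries.X, ← weightSeries_mul_right (cs.simple 2)]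
  · congr 1
    ext w
    constructor
    · rintro ⟨hw, hh⟩
      refine ⟨w * cs.simple 2, ⟨⟨?_, ?_⟩, ?_⟩, cs.simple_mul_simple_cancel_right 2⟩
      · rw [hyp.isRightDescent_mul_simple_two]
        exact hw.1
      · rw [hyp.isHorizontal_iff] at hh
        obtain ⟨hodd, u, hu, h | h, hn⟩ := hh
        · have := (hyp.descents_top cs hodd hu).2.1
          rw [← h] at this
          exact absurd this hw.2
        · rw [h]
          exact (hyp.descents_top cs hodd hu).1.2
      · rwa [hyp.isHorizontal_mul_simple_two]
    · rintro ⟨u, ⟨hu, hh⟩, rfl⟩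
      refine ⟨⟨(hyp.isRightDescent_mul_simple_two cs u).not.2 hu.1, ?_⟩,
        (hyp.isHorizontal_mul_simple_two cs).2 hh⟩
      rw [hyp.isHorizontal_iff] at hh
      obtain ⟨hodd, v, hv, h | h, hn⟩ := hh
      · have := (hyp.descents_top cs hodd hv).2.2
        rw [← h] at this
        exact hyp.not_isRightDescent_both cs this
      · have := (hyp.descents_top cs hodd hv).1.2
        rw [← h] at this
        exact absurd (cs.isRightDescent_mul_simple hu.2) this
  · intro w _
    rw [hyp.level_mul_simple_of_ne cs (by decide), add_zero]

omit hyp in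
theorem image_mul_eq_union (g : W) (S : Set W) (Q : W → Prop) (w : W) :
    w ∈ (· * g) '' S ↔ w ∈ (· * g) '' {u | u ∈ S ∧ Q u} ∨ w ∈ (· * g) '' {u | u ∈ S ∧ ¬Q u} := by
  simp only [Set.mem_image, Set.mem_ofPred_eq, ← exists_or]
  refine exists_congr fun u => ?_
  tauto

theorem weightSeries_image_split (g : W) (S : Set W) (Q : W → Prop) :
    weightSeries cs.level ((· * g) '' S) = weightSeries cs.level ((· * g) '' {u | u ∈ S ∧ Q u}) +
      weightSeries cs.level ((· * g) '' {u | u ∈ S ∧ ¬Q u}) := by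
  refine weightSeries_add_of_disjoint (hyp.finite_level_eq cs) ?_ (image_mul_eq_union g S Q)
  rw [Set.disjoint_image_iff (mul_left_injective g), Set.disjoint_left]
  exact fun w h h' => h'.2 h.2

theorem weightSeries_sum_image_split (n : ℕ) (e : ℕ → W) (S : Set W) (Q : W → Prop) :
    ∑ k ∈ Finset.range n, weightSeries cs.level ((· * e k) '' S) =
      ∑ k ∈ Finset.range n, weightSeries cs.level ((· * e k) '' {u | u ∈ S ∧ Q u}) +
      ∑ k ∈ Finset.range n, weightSeries cs.level ((· * e k) '' {u | u ∈ S ∧ ¬Q u}) := by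
  rw [← Finset.sum_add_distrib]
  exact Finset.sum_congr rfl fun k _ => hyp.weightSeries_image_split cs (e k) S Q

theorem weightSeries_split (S : Set W) (Q : W → Prop) :
    weightSeries cs.level S = weightSeries cs.level {u | u ∈ S ∧ Q u} +
      weightSeries cs.level {u | u ∈ S ∧ ¬Q u} := by
  simpa using hyp.weightSeries_image_split cs 1 S Q

/-- The growth series of the tessellation by faces of odd length. -/
theorem weightSeries_of_odd {p : ℕ} (hp : M 0 1 = 2 * p + 1) :
    ((1 + PowerSeries.X - (M 1 2 : ℂ⟦X⟧)) * (∑ k ∈ Finset.range p, (PowerSeries.X : ℂ⟦X⟧) ^ k) *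
      (1 + PowerSeries.X ^ p) + 2 * PowerSeries.X ^ p + (M 1 2 : ℂ⟦X⟧)) *
        weightSeries cs.level {w | cs.IsMinimal 1 2 w} =
    (1 + PowerSeries.X) * (∑ k ∈ Finset.range p, (PowerSeries.X : ℂ⟦X⟧) ^ k) *
      (1 + PowerSeries.X ^ p) + 2 * PowerSeries.X ^ p := by
  have hm := hyp.three_le_face
  have hA := hyp.weightSeries_univ_vertex cs
  have hE := hyp.weightSeries_euler cs
  have hG := hyp.weightSeries_univ cs (show (0 : Fin 3) ≠ 2 by decide)
  have hH := hyp.weightSeries_univ cs (show (0 : Fin 3) ≠ 1 by decide)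
  have hG0 := hyp.weightSeries_horizontal_edges cs hp
  have hH0 := hyp.weightSeries_horizontal_faces cs
  rw [hyp.weightSeries_split cs {w | cs.IsMinimal 0 2 w} cs.IsHorizontal,
    hyp.weightSeries_split cs {w | cs.IsMinimal 0 1 w} cs.IsHorizontal] at hE
  rw [hyp.weightSeries_sum_image_split cs _ (cs.alt 0 2) _ cs.IsHorizontal,
    hyp.weightSeries_sum_image_split cs _ (fun k => cs.alt 2 0 (k + 1)) _ cs.IsHorizontal] at hG
  rw [hyp.weightSeries_sum_image_split cs _ (cs.alt 0 1) _ cs.IsHorizontal,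
    hyp.weightSeries_sum_image_split cs _ (fun k => cs.alt 1 0 (k + 1)) _ cs.IsHorizontal] at hH
  simp only [Set.mem_ofPred_eq] at hG hH hE
  rw [add_add_add_comm,
    hyp.weightSeries_edges cs (d := 0)
      (S := {u | cs.IsMinimal 0 2 u ∧ cs.IsHorizontal u}) (fun w hw => hw.1)
      (fun w hw => cs.step_zero_of_isHorizontal hw.2),
    hyp.weightSeries_edges cs (d := 1)
      (S := {u | cs.IsMinimal 0 2 u ∧ ¬cs.IsHorizontal u}) (fun w hw => hw.1) (fun w hw => cs.step_zero hw.2),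
    hA] at hG
  -- The exponent uses truncated subtraction: `k = 0` and `k = 1` both give zero, since the bottom
  -- edge is horizontal.
  have e1 : ∀ k ∈ Finset.range (M 0 1), weightSeries cs.level ((· * cs.alt 0 1 k) ''
      {u | cs.IsMinimal 0 1 u ∧ cs.IsHorizontal u}) = PowerSeries.X ^ ((k - 1) / 2) *
        weightSeries cs.level {u | cs.IsMinimal 0 1 u ∧ cs.IsHorizontal u} := by
    rintro (_ | k) hk <;> rw [Finset.mem_range] at hk <;>
      refine weightSeries_mul_right _ fun w hw => ?_
    · simp
    · rcases Nat.lt_or_ge (k + 1) (M 0 1) with h | h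
      · rw [hyp.level_left cs hw.1 (by omega), cs.step_zero_of_isHorizontal hw.2]
        simp
      · omega
  have e1' : ∀ k ∈ Finset.range (M 0 1), weightSeries cs.level ((· * cs.alt 0 1 k) ''
      {u | cs.IsMinimal 0 1 u ∧ ¬cs.IsHorizontal u}) = PowerSeries.X ^ ((k + 1) / 2) *
        weightSeries cs.level {u | cs.IsMinimal 0 1 u ∧ ¬cs.IsHorizontal u} := by
    rintro (_ | k) hk <;> rw [Finset.mem_range] at hk <;>
      refine weightSeries_mul_right _ fun w hw => ?_
    · simp
    · rw [hyp.level_left cs hw.1 (by omega), cs.step_zero hw.2]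
      omega
  have e2 : ∀ S : Set W, (∀ w ∈ S, cs.IsMinimal 0 1 w) → ∀ k ∈ Finset.range (M 0 1),
      weightSeries cs.level ((· * cs.alt 1 0 (k + 1)) '' S) =
        PowerSeries.X ^ ((k + 1) / 2) * weightSeries cs.level S := by
    intro S hS k hk
    exact weightSeries_mul_right _ fun w hw =>
      hyp.level_right cs (hS w hw) (Finset.mem_range.1 hk)
  rw [Finset.sum_congr rfl e1, Finset.sum_congr rfl e1',
    Finset.sum_congr rfl (e2 _ fun w hw => hw.1), Finset.sum_congr rfl (e2 _ fun w hw => hw.1),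
    ← Finset.sum_mul, ← Finset.sum_mul, ← Finset.sum_mul, hp, sum_range_X_pow_half_pred,
    Finset.sum_range_succ, sum_range_X_pow_half_succ, show (2 * p + 1) / 2 = p by omega, hA] at hH
  have hgeom : (1 - PowerSeries.X) * ∑ k ∈ Finset.range p, (PowerSeries.X : ℂ⟦X⟧) ^ k =
      1 - PowerSeries.X ^ p := mul_neg_geom_sum _ _
  rw [hH0, hG0] at hE hH
  rw [hG0] at hG
  set P := ∑ k ∈ Finset.range p, (PowerSeries.X : ℂ⟦X⟧) ^ k
  set F := weightSeries cs.level {w | cs.IsMinimal 1 2 w}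
  set G₁ := weightSeries cs.level {w | cs.IsMinimal 0 2 w ∧ ¬cs.IsHorizontal w}
  set H₁ := weightSeries cs.level {w | cs.IsMinimal 0 1 w ∧ ¬cs.IsHorizontal w}
  set z := (PowerSeries.X : ℂ⟦X⟧) ^ p
  set l := (M 1 2 : ℂ⟦X⟧)
  have h1X : (1 + PowerSeries.X : ℂ⟦X⟧) ≠ 0 := by
    intro h
    have := congrArg (PowerSeries.coeff 0) h
    simp at this
  have hG' : l * F = 2 * z * H₁ + (1 + PowerSeries.X) * G₁ := by
    refine mul_left_cancel₀ PowerSeries.two_ne_zero ?_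
    linear_combination hG
  -- Substituting `z * H₁` for the faces with horizontal bottom and using `(1 - X) P = 1 - z` makes
  -- the coefficient symmetric.
  have hH' : l * F = ((1 + PowerSeries.X) * P * (1 + z) + 2 * z) * H₁ := by
    refine mul_left_cancel₀ PowerSeries.two_ne_zero ?_
    linear_combination hH + z * H₁ * hgeom
  -- The horizontal edges and faces cancel in the Euler relation. The remaining `G₁` is known only
  -- through `(1 + X) * G₁`, hence this factor.
  refine mul_left_cancel₀ h1X ?_
  linear_combination (1 + PowerSeries.X) * ((1 + PowerSeries.X) * P * (1 + z) + 2 * z) * hE -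
    ((1 + PowerSeries.X) * P * (1 + z) + 2 * z) * hG' + (1 + PowerSeries.X + 2 * z) * hH'

end CoxeterMatrix.IsHyperbolic
open scoped PowerSeries

/-! ### Fixed points of holomorphic self-maps of the unit disc -/

section Disc

open Metric ComplexConjugate

/-- The automorphism of the unit disc that sends `0` to `c`. -/
noncomputable def discShift (c z : ℂ) : ℂ := (z + c) / (1 + conj c * z)

theorem discShift_denom_ne_zero {c z : ℂ} (hc : ‖c‖ < 1) (hz : ‖z‖ < 1) :
    1 + conj c * z ≠ 0 := by
  intro h
  have h1 : ‖conj c * z‖ < 1 := by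
    rw [norm_mul, RCLike.norm_conj]
    exact mul_lt_one_of_nonneg_of_lt_one_left (norm_nonneg _) hc hz.le
  rw [eq_neg_of_add_eq_zero_right h, norm_neg, norm_one] at h1
  exact lt_irrefl _ h1

theorem norm_discShift_lt_one {c z : ℂ} (hc : ‖c‖ < 1) (hz : ‖z‖ < 1) : ‖discShift c z‖ < 1 := by
  have h := discShift_denom_ne_zero hc hz
  rw [discShift, norm_div, div_lt_one (norm_pos_iff.2 h)]
  refine lt_of_pow_lt_pow_left₀ 2 (norm_nonneg _) ?_
  have hc' : c.re ^ 2 + c.im ^ 2 < 1 := by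
    have := pow_lt_one₀ (norm_nonneg c) hc two_ne_zero
    rw [← Complex.normSq_eq_norm_sq, Complex.normSq_apply] at this
    linarith
  have hz' : z.re ^ 2 + z.im ^ 2 < 1 := by
    have := pow_lt_one₀ (norm_nonneg z) hz two_ne_zero
    rw [← Complex.normSq_eq_norm_sq, Complex.normSq_apply] at this
    linarith
  rw [← Complex.normSq_eq_norm_sq, ← Complex.normSq_eq_norm_sq, Complex.normSq_apply,
    Complex.normSq_apply]
  simp
  nlinarith [mul_pos (sub_pos.2 hc') (sub_pos.2 hz')]

theorem discShift_neg_discShift {c z : ℂ} (hc : ‖c‖ < 1) (hz : ‖z‖ < 1) :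
    discShift (-c) (discShift c z) = z := by
  have h1 := discShift_denom_ne_zero hc hz
  have h2 := discShift_denom_ne_zero (c := -c) (by rwa [norm_neg]) (norm_discShift_lt_one hc hz)
  rw [discShift, div_eq_iff h2, discShift, map_neg]
  have h4 : (z + c) / (1 + conj c * z) * (1 + conj c * z) = z + c := div_mul_cancel₀ _ h1
  linear_combination h4

theorem differentiableAt_discShift {c z : ℂ} (hc : ‖c‖ < 1) (hz : ‖z‖ < 1) :
    DifferentiableAt ℂ (discShift c) z := by
  have := discShift_denom_ne_zero hc hz
  unfold discShift
  fun_prop (disch := assumption)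

/-- A holomorphic self-map of the unit disc is the identity if it fixes two points, or if it fixes
one point with derivative one. -/
theorem eqOn_id_of_fixedPoint {f : ℂ → ℂ} (hd : DifferentiableOn ℂ f (ball 0 1))
    (hf : Set.MapsTo f (ball 0 1) (ball 0 1)) {c : ℂ} (hc : c ∈ ball (0 : ℂ) 1) (hfc : f c = c)
    (h : (∃ z ∈ ball (0 : ℂ) 1, z ≠ c ∧ f z = z) ∨ deriv f c = 1) :
    Set.EqOn f id (ball 0 1) := by
  have hc1 : ‖c‖ < 1 := mem_ball_zero_iff.1 hc
  have hc1' : ‖-c‖ < 1 := by rwa [norm_neg]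
  have hball : ∀ {a z : ℂ}, ‖a‖ < 1 → z ∈ ball (0 : ℂ) 1 → discShift a z ∈ ball (0 : ℂ) 1 :=
    fun ha hz => mem_ball_zero_iff.2 (norm_discShift_lt_one ha (mem_ball_zero_iff.1 hz))
  have hinv : ∀ {z : ℂ}, z ∈ ball (0 : ℂ) 1 → discShift c (discShift (-c) z) = z := by
    intro z hz
    have := discShift_neg_discShift hc1' (mem_ball_zero_iff.1 hz)
    rwa [neg_neg] at this
  have hzero : discShift c 0 = c := by simp [discShift]
  have h0 : (0 : ℂ) ∈ ball (0 : ℂ) 1 := mem_ball_self one_pos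
  set g : ℂ → ℂ := fun z => discShift (-c) (f (discShift c z)) with hg
  have hg0 : g 0 = 0 := by
    simp only [hg, hzero, hfc]
    simp [discShift]
  -- Conjugation by a disc automorphism moves the fixed point to `0`. Either alternative in `h` then
  -- gives a point where the slope of `g` from `0` is `1`, the equality case of the Schwarz lemma.
  have hgd : DifferentiableOn ℂ g (ball 0 1) := by
    intro z hz
    have h1 := differentiableAt_discShift hc1 (mem_ball_zero_iff.1 hz)
    have h2 := (hd.differentiableAt (isOpen_ball.mem_nhds (hball hc1 hz)))
    have h3 := differentiableAt_discShift hc1' (mem_ball_zero_iff.1 (hf (hball hc1 hz)))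
    exact (h3.comp z (h2.comp z h1)).differentiableWithinAt
  have hgm : Set.MapsTo g (ball 0 1) (closedBall (g 0) 1) := by
    intro z hz
    rw [hg0]
    exact ball_subset_closedBall (hball hc1' (hf (hball hc1 hz)))
  obtain ⟨z₀, hz₀, hs⟩ : ∃ z₀ ∈ ball (0 : ℂ) 1, dslope g 0 z₀ = 1 := by
    rcases h with ⟨z, hz, hne, hfz⟩ | hder
    · refine ⟨discShift (-c) z, hball hc1' hz, ?_⟩
      have hne' : discShift (-c) z ≠ 0 := by
        intro h
        have := hinv hz
        rw [h, hzero] at this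
        exact hne this.symm
      rw [dslope_of_ne _ hne', slope_def_field, hg0]
      simp only [hg, hinv hz, hfz, sub_zero]
      exact div_self hne'
    · refine ⟨0, h0, ?_⟩
      rw [dslope_same]
      have h1 : HasDerivAt (discShift c) (1 - conj c * c) 0 := by
        have hn : HasDerivAt (fun z : ℂ => z + c) 1 0 := (hasDerivAt_id 0).add_const c
        have hm : HasDerivAt (fun z : ℂ => 1 + conj c * z) (conj c * 1) 0 :=
          ((hasDerivAt_id 0).const_mul (conj c)).const_add 1
        exact (hn.div hm (by simp)).congr_deriv (by simp; ring)
      have hcc := discShift_denom_ne_zero hc1' hc1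
      have h3 : HasDerivAt (discShift (-c)) (1 / (1 - conj c * c)) c := by
        have hn : HasDerivAt (fun z : ℂ => z + -c) 1 c := (hasDerivAt_id c).add_const (-c)
        have hm : HasDerivAt (fun z : ℂ => 1 + conj (-c) * z) (conj (-c) * 1) c :=
          ((hasDerivAt_id c).const_mul (conj (-c))).const_add 1
        refine (hn.div hm hcc).congr_deriv ?_
        rw [map_neg, neg_mul, ← sub_eq_add_neg] at hcc
        simp only [map_neg, neg_mul, ← sub_eq_add_neg, sub_self, zero_mul, sub_zero, one_mul]
        field_simp
      have h2 : HasDerivAt f 1 c := by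
        rw [← hder]
        exact (hd.differentiableAt (isOpen_ball.mem_nhds hc)).hasDerivAt
      have h12 : HasDerivAt (fun z => f (discShift c z)) (1 * (1 - conj c * c)) 0 :=
        HasDerivAt.comp (h₂ := f) 0 (by rwa [hzero]) h1
      have h123 : HasDerivAt g (1 / (1 - conj c * c) * (1 * (1 - conj c * c))) 0 :=
        HasDerivAt.comp (h₂ := discShift (-c)) 0 (by rwa [hzero, hfc]) h12
      rw [h123.deriv]
      rw [map_neg, neg_mul, ← sub_eq_add_neg] at hcc
      field_simp
  have hid := Complex.affine_of_mapsTo_ball_of_norm_dslope_eq_div hgd hgm hz₀ (by simp [hs])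
  intro z hz
  have hz' : g (discShift (-c) z) = discShift (-c) z := by
    have := hid (hball hc1' hz)
    simpa only [hg0, hs, zero_add, sub_zero, smul_eq_mul, mul_one] using this
  simp only [hg, hinv hz] at hz'
  have h4 := hinv (hf hz)
  rw [hz', hinv hz] at h4
  exact h4.symm

open Polynomial in
/-- If `N / D` is a self-map of the unit disc not fixing `0`, then it has at most one fixed point
in the disc, and this fixed point is a simple root of `N - X * D`. -/
theorem root_unique_and_simple {N D : ℂ[X]} (hND : ∀ z : ℂ, ‖z‖ < 1 → ‖N.eval z‖ < ‖D.eval z‖)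
    (h0 : N.eval 0 ≠ 0) {c : ℂ} (hc : ‖c‖ < 1) (hroot : (N - X * D).eval c = 0) :
    (∀ z : ℂ, ‖z‖ < 1 → (N - X * D).eval z = 0 → z = c) ∧
      (N - X * D).derivative.eval c ≠ 0 := by
  have hD : ∀ z : ℂ, ‖z‖ < 1 → D.eval z ≠ 0 := fun z hz =>
    norm_pos_iff.1 ((norm_nonneg _).trans_lt (hND z hz))
  have hfix : ∀ z : ℂ, ‖z‖ < 1 → ((N - X * D).eval z = 0 ↔ N.eval z / D.eval z = z) := by
    intro z hz
    rw [div_eq_iff (hD z hz), eval_sub, eval_mul, eval_X, sub_eq_zero]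
  set f : ℂ → ℂ := fun z => N.eval z / D.eval z with hf
  have hd : DifferentiableOn ℂ f (ball 0 1) := fun z hz =>
    (N.differentiableAt.div D.differentiableAt
      (hD z (mem_ball_zero_iff.1 hz))).differentiableWithinAt
  have hm : Set.MapsTo f (ball 0 1) (ball 0 1) := by
    intro z hz
    rw [mem_ball_zero_iff] at hz ⊢
    rw [hf, norm_div, div_lt_one (norm_pos_iff.2 (hD z hz))]
    exact hND z hz
  have hfc : f c = c := (hfix c hc).1 hroot
  have hnot : ¬((∃ z ∈ ball (0 : ℂ) 1, z ≠ c ∧ f z = z) ∨ deriv f c = 1) := by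
    intro h
    -- The identity map would fix `0`, against `N(0) ≠ 0`.
    have := eqOn_id_of_fixedPoint hd hm (mem_ball_zero_iff.2 hc) hfc h (mem_ball_self one_pos)
    rw [id_eq, hf, div_eq_zero_iff] at this
    exact this.elim h0 (hD 0 (by simp))
  rw [not_or] at hnot
  constructor
  · intro z hz hr
    by_contra hne
    exact hnot.1 ⟨z, mem_ball_zero_iff.2 hz, hne, (hfix z hz).1 hr⟩
  · intro hder
    apply hnot.2
    have hDc := hD c hc
    have h1 := ((N.hasDerivAt c).div (D.hasDerivAt c) hDc).deriv
    have h2 : N.eval c = c * D.eval c := (div_eq_iff hDc).1 hfc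
    simp only [derivative_sub, derivative_mul, derivative_X, one_mul, eval_sub, eval_add, eval_mul,
      eval_X] at hder
    rw [show f = N.eval / D.eval from rfl] at *
    rw [h1, h2, div_eq_one_iff_eq (pow_ne_zero 2 hDc)]
    linear_combination D.eval c * hder

end Disc

/-! ### Coefficients of rational functions -/

section Growth

open Polynomial

/-- A rational function without poles in the closed disc of radius `ρ` is given there by an
absolutely convergent power series. -/
theorem exists_hasSum_of_mul_eq {ρ : ℝ} (hρ : 0 < ρ) (n : ℕ) : ∀ (Q N : ℂ[X]) (G : ℂ⟦X⟧),
    Q.natDegree = n → Q ≠ 0 → (∀ z : ℂ, Q.eval z = 0 → ρ < ‖z‖) →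
    (Q : ℂ⟦X⟧) * G = N →
    (Summable fun k => ‖PowerSeries.coeff k G‖ * ρ ^ k) ∧
      Q.eval (ρ : ℂ) * ∑' k, PowerSeries.coeff k G * (ρ : ℂ) ^ k = N.eval (ρ : ℂ) := by
  induction n with
  | zero =>
    intro Q N G hn hQ _ h
    obtain ⟨a, rfl⟩ := natDegree_eq_zero.1 hn
    have ha : a ≠ 0 := by
      rintro rfl
      simp at hQ
    have hG : G = ((C a⁻¹ * N : ℂ[X]) : ℂ⟦X⟧) := by
      rw [Polynomial.coe_mul, ← h, ← mul_assoc, ← Polynomial.coe_mul, ← C_mul, inv_mul_cancel₀ ha]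
      simp
    have hz : ∀ k ∉ Finset.range ((C a⁻¹ * N).natDegree + 1), PowerSeries.coeff k G = 0 := by
      intro k hk
      rw [hG, Polynomial.coeff_coe]
      apply coeff_eq_zero_of_natDegree_lt
      simpa using hk
    constructor
    · refine summable_of_ne_finset_zero (s := Finset.range ((C a⁻¹ * N).natDegree + 1)) ?_
      intro k hk
      rw [hz k hk, norm_zero, zero_mul]
    · rw [tsum_eq_sum (s := Finset.range ((C a⁻¹ * N).natDegree + 1))
        (fun k hk => by rw [hz k hk, zero_mul])]
      simp only [hG, Polynomial.coeff_coe]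
      rw [← eval_eq_sum_range, eval_mul, eval_C, eval_C, mul_inv_cancel_left₀ ha]
  | succ n ih =>
    intro Q N G hn hQ hroots h
    obtain ⟨α, hα⟩ := Complex.exists_root (f := Q) (by
      rw [degree_eq_natDegree hQ, hn]
      exact_mod_cast Nat.succ_pos n)
    obtain ⟨Q', rfl⟩ := dvd_iff_isRoot.2 hα
    have hQ' : Q' ≠ 0 := right_ne_zero_of_mul hQ
    have hα' : ρ < ‖α‖ := hroots α hα
    obtain ⟨h1, h2⟩ := ih Q' N (((X - C α : ℂ[X]) : ℂ⟦X⟧) * G)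
      (by rw [natDegree_mul (X_sub_C_ne_zero α) hQ', natDegree_X_sub_C] at hn; omega) hQ'
      (fun z hz => hroots z (by rw [eval_mul, hz, mul_zero]))
      (by rw [← h, Polynomial.coe_mul]; ring)
    have c0 : PowerSeries.coeff 0 (((X - C α : ℂ[X]) : ℂ⟦X⟧) * G) =
        -α * PowerSeries.coeff 0 G := by
      simp [sub_mul]
    have cs : ∀ k, PowerSeries.coeff (k + 1) (((X - C α : ℂ[X]) : ℂ⟦X⟧) * G) =
        PowerSeries.coeff k G - α * PowerSeries.coeff (k + 1) G := by
      intro k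
      rw [Polynomial.coe_sub, Polynomial.coe_X, Polynomial.coe_C, sub_mul, map_sub,
        PowerSeries.coeff_succ_X_mul, PowerSeries.coeff_C_mul]
    set H := ((X - C α : ℂ[X]) : ℂ⟦X⟧) * G
    have hsum : Summable fun k => ‖PowerSeries.coeff k G‖ * ρ ^ k := by
      refine summable_of_sum_range_le (c := (∑' k, ‖PowerSeries.coeff k H‖ * ρ ^ k) / (‖α‖ - ρ))
        (fun k => by positivity) fun K => ?_
      rw [le_div_iff₀ (sub_pos.2 hα')]
      -- With `H = (X - α) G`, the triangle inequality bounds `‖α‖ - ρ` times each partial sum for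
      -- `G` by a partial sum for `H`; this is where `ρ < ‖α‖` enters.
      have hle : ‖α‖ * ∑ k ∈ Finset.range K, ‖PowerSeries.coeff k G‖ * ρ ^ k ≤
          ∑ k ∈ Finset.range K, ‖PowerSeries.coeff k H‖ * ρ ^ k +
            ρ * ∑ k ∈ Finset.range K, ‖PowerSeries.coeff k G‖ * ρ ^ k := by
        have hnn : ∀ j, 0 ≤ ‖PowerSeries.coeff j G‖ * ρ ^ j := fun j => by positivity
        induction K with
        | zero => simp
        | succ K _ =>
          rw [Finset.sum_range_succ' _ K, Finset.sum_range_succ' (fun k => ‖PowerSeries.coeff k H‖ * ρ ^ k) K]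
          have hstep : ∀ k, ‖α‖ * (‖PowerSeries.coeff (k + 1) G‖ * ρ ^ (k + 1)) ≤
              ‖PowerSeries.coeff (k + 1) H‖ * ρ ^ (k + 1) +
                ρ * (‖PowerSeries.coeff k G‖ * ρ ^ k) := by
            intro k
            have e : α * PowerSeries.coeff (k + 1) G =
                PowerSeries.coeff k G - PowerSeries.coeff (k + 1) H := by
              rw [cs]; ring
            have : ‖α‖ * ‖PowerSeries.coeff (k + 1) G‖ ≤
                ‖PowerSeries.coeff k G‖ + ‖PowerSeries.coeff (k + 1) H‖ := by
              rw [← norm_mul, e]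
              exact norm_sub_le _ _
            calc _ = (‖α‖ * ‖PowerSeries.coeff (k + 1) G‖) * ρ ^ (k + 1) := by ring
              _ ≤ (‖PowerSeries.coeff k G‖ + ‖PowerSeries.coeff (k + 1) H‖) * ρ ^ (k + 1) := by
                gcongr
              _ = _ := by ring
          have h00 : ‖α‖ * ‖PowerSeries.coeff 0 G‖ = ‖PowerSeries.coeff 0 H‖ := by
            rw [c0, norm_mul, norm_neg]
          have hs := Finset.sum_le_sum fun k (_ : k ∈ Finset.range K) => hstep k
          rw [← Finset.mul_sum, Finset.sum_add_distrib, ← Finset.mul_sum] at hs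
          have hlast := Finset.sum_range_succ (fun k => ‖PowerSeries.coeff k G‖ * ρ ^ k) K
          rw [Finset.sum_range_succ'] at hlast
          rw [hlast]
          have : ‖α‖ * (∑ k ∈ Finset.range K, ‖PowerSeries.coeff k G‖ * ρ ^ k +
              ‖PowerSeries.coeff K G‖ * ρ ^ K) =
              ‖α‖ * ∑ k ∈ Finset.range K, ‖PowerSeries.coeff (k + 1) G‖ * ρ ^ (k + 1) +
                ‖α‖ * ‖PowerSeries.coeff 0 G‖ := by
            rw [← hlast]
            ring
          rw [this, h00, mul_add]
          have := mul_nonneg hρ.le (hnn K)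
          simp only [pow_zero, mul_one]
          linarith
      have := h1.sum_le_tsum (Finset.range K) (fun k _ => by positivity)
      linarith
    refine ⟨hsum, ?_⟩
    have hG : Summable fun k => PowerSeries.coeff k G * (ρ : ℂ) ^ k := by
      refine Summable.of_norm ?_
      simpa [abs_of_pos hρ] using hsum
    have hH : Summable fun k => PowerSeries.coeff k H * (ρ : ℂ) ^ k := by
      refine Summable.of_norm ?_
      simpa [abs_of_pos hρ] using h1
    rw [← h2, eval_mul, eval_sub, eval_X, eval_C, mul_comm ((ρ : ℂ) - α), mul_assoc]
    congr 1
    rw [hH.tsum_eq_zero_add, c0]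
    simp only [cs]
    have hG' := (summable_nat_add_iff 1).2 hG
    have e : ∀ k, (PowerSeries.coeff k G - α * PowerSeries.coeff (k + 1) G) * (ρ : ℂ) ^ (k + 1) =
        (ρ : ℂ) * (PowerSeries.coeff k G * (ρ : ℂ) ^ k) -
          α * (PowerSeries.coeff (k + 1) G * (ρ : ℂ) ^ (k + 1)) := fun k => by ring
    simp only [e]
    rw [(hG.mul_left _).tsum_sub (hG'.mul_left _), tsum_mul_left, tsum_mul_left, sub_mul]
    nth_rw 2 [hG.tsum_eq_zero_add]
    ring

/-- If the dominant pole `r` of the generating function of `f` is simple, then `f n * r ^ n`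
converges to a positive limit. -/
theorem tendsto_mul_pow_of_mul_eq {f : ℕ → ℕ} {Q N : ℂ[X]} {r : ℝ} (hr : 0 < r)
    (h : (Q : ℂ⟦X⟧) * PowerSeries.mk (fun n => (f n : ℂ)) = N) (hN : N.eval (r : ℂ) ≠ 0)
    (hQr : Q.eval (r : ℂ) = 0) (hQr' : Q.derivative.eval (r : ℂ) ≠ 0)
    (hroots : ∀ z : ℂ, Q.eval z = 0 → z ≠ r → r < ‖z‖) :
    ∃ L : ℝ, 0 < L ∧ Tendsto (fun n => (f n : ℝ) * r ^ n) atTop (𝓝 L) := by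
  obtain ⟨Q', hQ'⟩ := dvd_iff_isRoot.2 (show Q.IsRoot (r : ℂ) from hQr)
  have hQ'r : Q'.eval (r : ℂ) ≠ 0 := by
    rw [hQ'] at hQr'
    simpa using hQr'
  have hQ'0 : Q' ≠ 0 := by
    rintro rfl
    simp at hQ'r
  set F : ℂ⟦X⟧ := PowerSeries.mk (fun n => (f n : ℂ)) with hF
  obtain ⟨h1, h2⟩ := exists_hasSum_of_mul_eq hr _ Q' N (((X - C (r : ℂ) : ℂ[X]) : ℂ⟦X⟧) * F) rfl hQ'0
    (fun z hz => by
      refine hroots z (by rw [hQ', eval_mul, hz, mul_zero]) ?_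
      rintro rfl
      exact hQ'r hz)
    (by rw [← h, hQ', Polynomial.coe_mul]; ring)
  have c0 : PowerSeries.coeff 0 (((X - C (r : ℂ) : ℂ[X]) : ℂ⟦X⟧) * F) = -(r : ℂ) * f 0 := by
    simp [sub_mul, hF]
  have cs : ∀ k, PowerSeries.coeff (k + 1) (((X - C (r : ℂ) : ℂ[X]) : ℂ⟦X⟧) * F) =
      f k - r * f (k + 1) := by
    intro k
    rw [Polynomial.coe_sub, Polynomial.coe_X, Polynomial.coe_C, sub_mul, map_sub,
      PowerSeries.coeff_succ_X_mul, PowerSeries.coeff_C_mul]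
    simp [hF]
  set H := ((X - C (r : ℂ) : ℂ[X]) : ℂ⟦X⟧) * F
  have hH : Summable fun k => PowerSeries.coeff k H * (r : ℂ) ^ k := by
    refine Summable.of_norm ?_
    simpa [abs_of_pos hr] using h1
  -- The partial sums of `(X - r) F` at `r` telescope to a multiple of `f n * r ^ n`, so convergence
  -- at `r` is exactly the desired limit.
  have hpart : ∀ n, ∑ k ∈ Finset.range (n + 1), PowerSeries.coeff k H * (r : ℂ) ^ k =
      -(r : ℂ) * (((f n : ℝ) * r ^ n : ℝ) : ℂ) := by
    intro n
    induction n with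
    | zero => simp [c0]
    | succ n ih =>
      rw [Finset.sum_range_succ, ih, cs]
      push_cast
      ring
  have hlim := (hH.hasSum.tendsto_sum_nat.comp (tendsto_add_atTop_nat 1))
  set S := ∑' k, PowerSeries.coeff k H * (r : ℂ) ^ k
  have hS : S ≠ 0 := by
    intro hS
    rw [hS, mul_zero] at h2
    exact hN h2.symm
  have hrc : (r : ℂ) ≠ 0 := by exact_mod_cast hr.ne'
  have hlim' : Tendsto (fun n => (((f n : ℝ) * r ^ n : ℝ) : ℂ)) atTop (𝓝 (-(r : ℂ)⁻¹ * S)) := by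
    have := hlim.const_mul (-(r : ℂ)⁻¹)
    refine this.congr fun n => ?_
    rw [Function.comp_apply, hpart]
    field_simp
  have hre : Tendsto (fun n => (f n : ℝ) * r ^ n) atTop (𝓝 (-(r : ℂ)⁻¹ * S).re) := by
    have := (Complex.continuous_re.tendsto _).comp hlim'
    simpa only [Function.comp_def, Complex.ofReal_re] using this
  have hreal : (((-(r : ℂ)⁻¹ * S).re : ℝ) : ℂ) = -(r : ℂ)⁻¹ * S :=
    tendsto_nhds_unique ((Complex.continuous_ofReal.tendsto _).comp hre) hlim'
  refine ⟨_, lt_of_le_of_ne ?_ ?_, hre⟩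
  · exact ge_of_tendsto' hre fun n => by positivity
  · intro h0
    rw [← h0, Complex.ofReal_zero, eq_comm, mul_eq_zero] at hreal
    exact hreal.elim (neg_ne_zero.2 (inv_ne_zero hrc)) hS

theorem tendsto_rpow_of_tendsto_mul_pow {f : ℕ → ℕ} {r L : ℝ} (hr : 0 < r) (hL : 0 < L)
    (h : Tendsto (fun n => (f n : ℝ) * r ^ n) atTop (𝓝 L)) :
    Tendsto (fun n : ℕ => (f n : ℝ) ^ ((1 : ℝ) / n)) atTop (𝓝 r⁻¹) := by
  have h1 := h.rpow tendsto_one_div_atTop_nhds_zero_nat (Or.inl hL.ne')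
  rw [Real.rpow_zero] at h1
  have h2 := h1.mul_const r⁻¹
  rw [one_mul] at h2
  refine h2.congr' ?_
  filter_upwards [eventually_ne_atTop 0] with n hn
  have hn' : (n : ℝ) ≠ 0 := by exact_mod_cast hn
  rw [Real.mul_rpow (by positivity) (by positivity), ← Real.rpow_natCast, ← Real.rpow_mul hr.le,
    mul_one_div_cancel hn', Real.rpow_one, mul_assoc, mul_inv_cancel₀ hr.ne', mul_one]

/-- A denominator in lowest terms divides every other denominator of the same series. -/
theorem isRoot_of_isPoleOf {F : ℂ⟦X⟧} {Q N : ℂ[X]} (h : (Q : ℂ⟦X⟧) * F = N) {z : ℂ}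
    (hz : IsPoleOf F z) : Q.IsRoot z := by
  obtain ⟨P', Q', hco, he, hroot⟩ := hz
  have hdvd : Q' ∣ P' * Q := by
    refine ⟨N, ?_⟩
    apply Polynomial.coe_injective ℂ
    rw [Polynomial.coe_mul, Polynomial.coe_mul, ← h, ← he]
    ring
  exact hroot.dvd (hco.symm.dvd_of_dvd_mul_left hdvd)

theorem isPoleOf_of_isRoot {F : ℂ⟦X⟧} {Q N : ℂ[X]} (h : (Q : ℂ⟦X⟧) * F = N) (hQ : Q ≠ 0) {z : ℂ}
    (hz : Q.IsRoot z) (hN : ¬N.IsRoot z) : IsPoleOf F z := by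
  obtain ⟨g, n, q, a, b, hn, hq, hab⟩ : ∃ g n q a b : ℂ[X], N = g * n ∧ Q = g * q ∧
      g = N * a + Q * b := by
    obtain ⟨n, hn⟩ := EuclideanDomain.gcd_dvd_left N Q
    obtain ⟨q, hq⟩ := EuclideanDomain.gcd_dvd_right N Q
    exact ⟨_, n, q, _, _, hn, hq, EuclideanDomain.gcd_eq_gcd_ab N Q⟩
  have hg : g ≠ 0 := by
    rintro rfl
    exact hQ (by rw [hq, zero_mul])
  refine ⟨n, q, ⟨a, b, mul_left_cancel₀ hg ?_⟩, ?_, ?_⟩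
  · rw [hn, hq] at hab
    linear_combination -hab
  · have hg' : (g : ℂ⟦X⟧) ≠ 0 := by
      rw [Ne, ← Polynomial.coe_zero (R := ℂ)]
      exact fun h => hg (Polynomial.coe_injective ℂ h)
    apply mul_left_cancel₀ hg'
    rw [← mul_assoc, ← Polynomial.coe_mul, ← Polynomial.coe_mul, ← hn, ← hq, h]
  · rw [IsRoot, hq, eval_mul, mul_eq_zero] at hz
    refine hz.resolve_left fun hgz => hN ?_
    rw [IsRoot, hn, eval_mul, hgz, zero_mul]

end Growth
open scoped PowerSeries

/-! ### Salem numbers from reciprocal polynomials -/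

section Salem

open Polynomial

/-- Conjugates of `r⁻¹` are roots of `Q`, and inversion turns uniqueness inside the disc into
uniqueness outside. Integrality comes from the reversed polynomial, which is monic because `Q(0) =
1`. -/
theorem isSalemNumber_inv {Q : ℤ[X]} {r : ℝ} (hr0 : 0 < r) (hr1 : r < 1) (h0 : Q.coeff 0 = 1)
    (hrec : ∀ z : ℂ, aeval z Q = 0 → aeval z⁻¹ Q = 0) (hroot : aeval (r : ℂ) Q = 0)
    (huniq : ∀ z : ℂ, ‖z‖ < 1 → aeval z Q = 0 → z = r) : IsSalemNumber r⁻¹ := by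
  have hrR : aeval r Q = 0 := by
    have := aeval_algebraMap_apply ℂ r Q
    rw [Complex.coe_algebraMap, hroot] at this
    exact_mod_cast this.symm
  have hlamC : aeval ((r⁻¹ : ℝ) : ℂ) Q = 0 := by
    rw [Complex.ofReal_inv]
    exact hrec _ hroot
  have hlamR : aeval r⁻¹ Q = 0 := by
    have := aeval_algebraMap_apply ℂ r⁻¹ Q
    rw [Complex.coe_algebraMap, hlamC] at this
    exact_mod_cast this.symm
  have h1lam : 1 < r⁻¹ := (one_lt_inv₀ hr0).2 hr1
  have hint : IsIntegral ℤ r⁻¹ := by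
    refine ⟨Q.reverse, ?_, ?_⟩
    · rw [Monic, reverse_leadingCoeff, trailingCoeff, natTrailingDegree_eq_zero.2, h0]
      right
      rw [h0]
      exact one_ne_zero
    · let := invertibleOfNonzero hr0.ne'
      rw [← invOf_eq_inv, eval₂_reverse_eq_zero_iff]
      exact hrR
  set P := minpoly ℚ r⁻¹ with hP
  have hintQ : IsIntegral ℚ r⁻¹ := hint.tower_top
  have hPQ : ∀ z : ℂ, aeval z P = 0 → aeval z Q = 0 := by
    intro z hz
    have hdvd : P ∣ Q.map (algebraMap ℤ ℚ) := minpoly.dvd ℚ _ (by rwa [aeval_map_algebraMap])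
    obtain ⟨R, hR⟩ := hdvd
    rw [← aeval_map_algebraMap ℚ, hR, map_mul, hz, zero_mul]
  have hclass : ∀ z : ℂ, aeval z P = 0 → z = r ∨ z = ((r⁻¹ : ℝ) : ℂ) ∨ ‖z‖ = 1 := by
    intro z hz
    have hzQ := hPQ z hz
    rcases lt_trichotomy ‖z‖ 1 with h | h | h
    · exact Or.inl (huniq z h hzQ)
    · exact Or.inr (Or.inr h)
    · refine Or.inr (Or.inl ?_)
      have := huniq z⁻¹ (by rw [norm_inv]; exact inv_lt_one_of_one_lt₀ h) (hrec z hzQ)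
      rw [Complex.ofReal_inv, ← this, inv_inv]
  refine ⟨h1lam, hint, ?_, ?_⟩
  · rw [inv_inv]
    by_contra hne
    -- If `r` were not a conjugate, the other conjugates would be unimodular. There is at least one,
    -- since in degree one `r⁻¹` would be an integer greater than `1` dividing `Q(0) = 1`.
    have hroots : ∀ z : ℂ, aeval z P = 0 → z = ((r⁻¹ : ℝ) : ℂ) ∨ ‖z‖ = 1 := by
      intro z hz
      refine (hclass z hz).resolve_left ?_
      rintro rfl
      have := aeval_algebraMap_apply ℂ r P
      rw [Complex.coe_algebraMap, hz] at this
      exact hne (by exact_mod_cast this.symm)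
    have hirr : Irreducible P := minpoly.irreducible hintQ
    have hdeg : P.natDegree ≠ 1 := by
      intro hdeg
      obtain ⟨q, hq⟩ := minpoly.natDegree_eq_one_iff.1 hdeg
      have hqint : IsIntegral ℤ q := by
        rw [← hq] at hint
        exact (isIntegral_algebraMap_iff (algebraMap ℚ ℝ).injective).1 hint
      obtain ⟨n, hn⟩ := IsIntegrallyClosed.isIntegral_iff.1 hqint
      have hn' : (n : ℝ) = r⁻¹ := by
        rw [← hq, ← hn]
        simp
      have hQn : Q.eval n = 0 := by
        have := aeval_algebraMap_apply ℝ n Q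
        rw [show algebraMap ℤ ℝ n = r⁻¹ by rw [← hn']; simp, hlamR] at this
        have h2 : aeval n Q = 0 := by
          have h3 : ((aeval n Q : ℤ) : ℝ) = 0 := by simpa using this.symm
          exact_mod_cast h3
        rwa [coe_aeval_eq_eval] at h2
      have hdvd := Q.sub_dvd_eval_sub n 0
      rw [hQn, ← coeff_zero_eq_eval_zero, h0, sub_zero, zero_sub, dvd_neg] at hdvd
      have h1 := Int.le_of_dvd one_pos hdvd
      have h2 : (1 : ℝ) < n := hn' ▸ h1lam
      have h3 : 1 < n := by exact_mod_cast h2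
      omega
    have hcard : Fintype.card (P.rootSet ℂ) = P.natDegree :=
      card_rootSet_eq_natDegree hirr.separable (IsAlgClosed.splits _)
    have hpos := hirr.natDegree_pos
    have hlamP : aeval ((r⁻¹ : ℝ) : ℂ) P = 0 := by
      rw [← Complex.coe_algebraMap, aeval_algebraMap_apply, hP, minpoly.aeval, map_zero]
    obtain ⟨⟨z, hzm⟩, hzne⟩ := Fintype.exists_ne_of_one_lt_card (by rw [hcard]; omega)
      (⟨_, (mem_rootSet.2 ⟨hirr.ne_zero, hlamP⟩)⟩ : P.rootSet ℂ)
    have hz := (mem_rootSet.1 hzm).2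
    have hz1 : ‖z‖ = 1 := (hroots z hz).resolve_left fun h => hzne (Subtype.ext h)
    have hz0 : z ≠ 0 := by
      rintro rfl
      simp at hz1
    -- For unimodular `z` the inverse is the complex conjugate, so `P` and its reverse share the
    -- root `z`; irreducibility makes `P` divide its reverse, which forces `r` to be a root.
    have hzinv : aeval z⁻¹ P = 0 := by
      rw [Complex.inv_eq_conj hz1]
      have := aeval_algHom_apply (Complex.conjAe.toAlgHom.restrictScalars ℚ) z P
      rw [hz, map_zero] at this
      exact this
    have hrev : aeval z P.reverse = 0 := by
      let := invertibleOfNonzero (inv_ne_zero hz0)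
      have := eval₂_reverse_eq_zero_iff (algebraMap ℚ ℂ) z⁻¹ P
      rw [invOf_eq_inv, inv_inv] at this
      exact this.2 hzinv
    have hmin : P = minpoly ℚ z :=
      minpoly.eq_of_irreducible_of_monic hirr hz (minpoly.monic hintQ)
    obtain ⟨R, hR⟩ := minpoly.dvd ℚ z hrev
    rw [← hmin] at hR
    have hlam : aeval r⁻¹ P.reverse = 0 := by rw [hR, map_mul, hP, minpoly.aeval, zero_mul]
    let := invertibleOfNonzero hr0.ne'
    rw [← invOf_eq_inv] at hlam
    exact hne ((eval₂_reverse_eq_zero_iff (algebraMap ℚ ℝ) r P).1 hlam)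
  · intro z hz h1 h2
    rcases hclass z hz with h | h | h
    · exact absurd (by rw [h, Complex.ofReal_inv, inv_inv]) h2
    · exact absurd h h1
    · exact h

/-- Salem growth of a sequence whose generating function is `N / Q`, where `(1 - X) * Q = A - X * D`
is antireciprocal and `A / D` is a self-map of the unit disc. -/
theorem exists_salem_growth {f : ℕ → ℕ} {Q N A D : ℤ[X]}
    (hF : ((Q.map (Int.castRingHom ℂ) : ℂ[X]) : ℂ⟦X⟧) * PowerSeries.mk (fun n => (f n : ℂ)) =
      ((N.map (Int.castRingHom ℂ) : ℂ[X]) : ℂ⟦X⟧))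
    (hN : ∀ x : ℝ, 0 < x → 0 < aeval x N) (h0 : Q.eval 0 = 1) (h1 : Q.eval 1 < 0)
    (hQ : (1 - X) * Q = A - X * D) (hA : A.eval 0 = 1)
    (hAD : ∀ z : ℂ, ‖z‖ < 1 → ‖aeval z A‖ < ‖aeval z D‖)
    (hrec : ∀ z : ℂ, z ≠ 0 → aeval z A = z * aeval z D → aeval z⁻¹ A = z⁻¹ * aeval z⁻¹ D) :
    ∃ lam : ℝ, IsSalemNumber lam ∧
      Tendsto (fun n : ℕ => (f n : ℝ) ^ ((1 : ℝ) / n)) atTop (𝓝 lam) ∧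
      IsPoleOf (PowerSeries.mk (fun n => (f n : ℂ))) (lam : ℂ)⁻¹ ∧
      ∀ z : ℂ, IsPoleOf (PowerSeries.mk (fun n => (f n : ℂ))) z → z ≠ (lam : ℂ)⁻¹ →
        lam⁻¹ < ‖z‖ := by
  have hev : ∀ (z : ℂ) (R : ℤ[X]), (R.map (Int.castRingHom ℂ)).eval z = aeval z R := by
    intro z R
    rw [eval_map, aeval_def]
    rfl
  have hQz : ∀ z : ℂ, (1 - z) * aeval z Q = aeval z A - z * aeval z D := by
    intro z
    have := congrArg (aeval z) hQ
    simpa using this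
  have hQ0 : aeval (0 : ℂ) Q = 1 := by
    have := aeval_algebraMap_apply ℂ (0 : ℤ) Q
    rw [coe_aeval_eq_eval, h0] at this
    simpa using this
  have hQ1 : aeval (1 : ℂ) Q ≠ 0 := by
    have := aeval_algebraMap_apply ℂ (1 : ℤ) Q
    rw [coe_aeval_eq_eval] at this
    simp only [map_one, algebraMap_int_eq, eq_intCast] at this
    rw [this]
    exact_mod_cast h1.ne
  have hrecQ : ∀ z : ℂ, aeval z Q = 0 → aeval z⁻¹ Q = 0 := by
    intro z hz
    have hz0 : z ≠ 0 := by
      rintro rfl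
      rw [hQ0] at hz
      exact one_ne_zero hz
    have hz1 : z⁻¹ ≠ 1 := by
      intro h
      rw [inv_eq_one.1 h] at hz
      exact hQ1 hz
    have h2 := hQz z
    rw [hz, mul_zero, eq_comm, sub_eq_zero] at h2
    have h3 := hQz z⁻¹
    rw [hrec z hz0 h2, sub_self, mul_eq_zero] at h3
    exact h3.resolve_left fun h => hz1 (sub_eq_zero.1 h).symm
  obtain ⟨r, hr, hrr⟩ : ∃ r ∈ Set.Ioo (0 : ℝ) 1, aeval r Q = 0 := by
    have hc : ContinuousOn (fun x : ℝ => aeval x Q) (Set.Icc 0 1) :=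
      (Polynomial.continuous_aeval Q).continuousOn
    have := intermediate_value_Ioo' zero_le_one hc
    refine this ⟨?_, ?_⟩
    · have := aeval_algebraMap_apply ℝ (1 : ℤ) Q
      rw [coe_aeval_eq_eval] at this
      simp only [map_one, algebraMap_int_eq, eq_intCast] at this
      simp only [this]
      exact_mod_cast h1
    · have := aeval_algebraMap_apply ℝ (0 : ℤ) Q
      rw [coe_aeval_eq_eval, h0] at this
      simp only [map_zero, map_one] at this
      simp only [this]
      exact one_pos
  have hrC : aeval (r : ℂ) Q = 0 := by
    rw [← Complex.coe_algebraMap, aeval_algebraMap_apply, hrr, map_zero]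
  have hr1 : ‖(r : ℂ)‖ < 1 := by
    rw [Complex.norm_real, Real.norm_of_nonneg hr.1.le]
    exact hr.2
  have hmapQ : (1 - X) * Q.map (Int.castRingHom ℂ) =
      A.map (Int.castRingHom ℂ) - X * D.map (Int.castRingHom ℂ) := by
    have := congrArg (Polynomial.map (Int.castRingHom ℂ)) hQ
    simpa using this
  obtain ⟨huniq, hsimple⟩ := root_unique_and_simple (N := A.map (Int.castRingHom ℂ))
    (D := D.map (Int.castRingHom ℂ)) (fun z hz => by rw [hev, hev]; exact hAD z hz)
    (by
      have := aeval_algebraMap_apply ℂ (0 : ℤ) A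
      rw [coe_aeval_eq_eval, hA, map_zero, map_one] at this
      rw [hev, this]
      exact one_ne_zero) hr1
    (by rw [← hmapQ, eval_mul, hev, hrC, mul_zero])
  have huniqQ : ∀ z : ℂ, ‖z‖ < 1 → aeval z Q = 0 → z = r := by
    intro z hz hzQ
    refine huniq z hz ?_
    rw [← hmapQ, eval_mul, hev, hzQ, mul_zero]
  have hsimpleQ : (Q.map (Int.castRingHom ℂ)).derivative.eval (r : ℂ) ≠ 0 := by
    intro h
    apply hsimple
    rw [← hmapQ, derivative_mul, eval_add, eval_mul, eval_mul, h, hev, hrC]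
    simp
  have hQne : Q.map (Int.castRingHom ℂ) ≠ 0 := by
    intro h
    have := hev 0 Q
    rw [h, hQ0, eval_zero] at this
    exact zero_ne_one this
  have hNr : (N.map (Int.castRingHom ℂ)).eval (r : ℂ) ≠ 0 := by
    rw [hev, ← Complex.coe_algebraMap, aeval_algebraMap_apply]
    -- Positivity of the numerator on the positive axis ensures that the pole at `r` is not
    -- cancelled.
    exact (_root_.map_ne_zero _).2 (hN r hr.1).ne'
  have hother : ∀ z : ℂ, (Q.map (Int.castRingHom ℂ)).eval z = 0 → z ≠ r → r < ‖z‖ := by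
    intro z hz hne
    rw [hev] at hz
    by_contra hlt
    exact hne (huniqQ z ((not_lt.1 hlt).trans_lt hr.2) hz)
  obtain ⟨L, hL, hlim⟩ := tendsto_mul_pow_of_mul_eq hr.1 hF hNr (by rw [hev, hrC]) hsimpleQ hother
  refine ⟨r⁻¹, isSalemNumber_inv hr.1 hr.2 (by rw [coeff_zero_eq_eval_zero, h0]) hrecQ hrC huniqQ,
    tendsto_rpow_of_tendsto_mul_pow hr.1 hL hlim, ?_, ?_⟩
  · rw [Complex.ofReal_inv, inv_inv]
    exact isPoleOf_of_isRoot hF hQne (by rw [IsRoot, hev, hrC]) hNr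
  · intro z hz hne
    rw [Complex.ofReal_inv, inv_inv] at hne
    rw [inv_inv]
    exact hother z (isRoot_of_isPoleOf hF hz) hne

theorem norm_one_add_mul_lt {a : ℝ} (ha : 1 < a) {w : ℂ} (hw : ‖w‖ < 1) :
    ‖1 + a * w‖ < ‖a + w‖ := by
  refine lt_of_pow_lt_pow_left₀ 2 (norm_nonneg _) ?_
  have hw' : w.re ^ 2 + w.im ^ 2 < 1 := by
    have := pow_lt_one₀ (norm_nonneg w) hw two_ne_zero
    rw [← Complex.normSq_eq_norm_sq, Complex.normSq_apply] at this
    linarith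
  rw [← Complex.normSq_eq_norm_sq, ← Complex.normSq_eq_norm_sq, Complex.normSq_apply,
    Complex.normSq_apply]
  simp
  have ha2 : 0 < a ^ 2 - 1 := by nlinarith
  nlinarith [mul_pos ha2 (sub_pos.2 hw')]

/-- The difference of squared norms factors as `(a - 1)(1 - |w|²)((a + 1)(1 + |w|²) + 4 Re w)`, and
the last factor is positive because `1 + |w|² + 2 Re w ≥ 0`. -/
theorem norm_one_add_mul_add_mul_lt {a : ℝ} (ha : 1 < a) {w : ℂ} (hw : ‖w‖ < 1) :
    ‖1 + 2 * w + a * w ^ 2‖ < ‖a + 2 * w + w ^ 2‖ := by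
  refine lt_of_pow_lt_pow_left₀ 2 (norm_nonneg _) ?_
  have hw' : w.re ^ 2 + w.im ^ 2 < 1 := by
    have := pow_lt_one₀ (norm_nonneg w) hw two_ne_zero
    rw [← Complex.normSq_eq_norm_sq, Complex.normSq_apply] at this
    linarith
  rw [← Complex.normSq_eq_norm_sq, ← Complex.normSq_eq_norm_sq, Complex.normSq_apply,
    Complex.normSq_apply]
  simp [pow_two]
  have h2 : 0 < (a + 1) * (1 + w.re ^ 2 + w.im ^ 2) + 4 * w.re := by
    nlinarith [sq_nonneg (w.re + 1), sq_nonneg w.im, mul_nonneg (sub_pos.2 ha).le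
      (add_nonneg (add_nonneg zero_le_one (sq_nonneg w.re)) (sq_nonneg w.im))]
  have := mul_pos (mul_pos (sub_pos.2 ha) (sub_pos.2 hw')) h2
  linarith

end Salem

/-! ### The main theorem -/

section Main

open Polynomial

theorem growthSeries_tessellation {ℓ m : ℕ} {hℓ : 3 ≤ ℓ} {hm : 3 ≤ m}
    (hyp : 4 < (ℓ - 2) * (m - 2)) (o : TessellationCell ℓ m hℓ hm 0) :
    growthSeries (tessellationGraph ℓ m hℓ hm) o =
      weightSeries (tessellationMatrix ℓ m hℓ hm).toCoxeterSystem.level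
        {w | (tessellationMatrix ℓ m hℓ hm).toCoxeterSystem.IsMinimal 1 2 w} := by
  ext n
  rw [growthSeries, weightSeries, PowerSeries.coeff_mk, PowerSeries.coeff_mk,
    graphSphere_ncard hyp]
  rfl

theorem exists_salem_growth_of_even {ℓ p : ℕ} (hℓ : 3 ≤ ℓ) (hyp : 4 < (ℓ - 2) * (2 * p - 2))
    {f : ℕ → ℕ}
    (hF : ((1 + PowerSeries.X - (ℓ : ℂ⟦X⟧)) * ∑ k ∈ Finset.range p, (PowerSeries.X : ℂ⟦X⟧) ^ k +
      (ℓ : ℂ⟦X⟧)) * PowerSeries.mk (fun n => (f n : ℂ)) =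
        (1 + PowerSeries.X) * ∑ k ∈ Finset.range p, (PowerSeries.X : ℂ⟦X⟧) ^ k) :
    ∃ lam : ℝ, IsSalemNumber lam ∧
      Tendsto (fun n : ℕ => (f n : ℝ) ^ ((1 : ℝ) / n)) atTop (𝓝 lam) ∧
      IsPoleOf (PowerSeries.mk (fun n => (f n : ℂ))) (lam : ℂ)⁻¹ ∧
      ∀ z : ℂ, IsPoleOf (PowerSeries.mk (fun n => (f n : ℂ))) z → z ≠ (lam : ℂ)⁻¹ →
        lam⁻¹ < ‖z‖ := by
  have hp : p ≠ 0 := by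
    rintro rfl
    simp at hyp
  have hgeom : (1 - X) * ∑ k ∈ Finset.range p, (X : ℤ[X]) ^ k = 1 - X ^ p := mul_neg_geom_sum _ _
  have ha : (1 : ℝ) < ℓ - 1 := by
    have : (3 : ℝ) ≤ ℓ := by exact_mod_cast hℓ
    linarith
  -- Multiplying the denominator by `1 - X` collapses the geometric sum. What remains is `A - X * D`
  -- with `A / D = (1 + a w) / (a + w)`, where `w = X ^ p` and `a = ℓ - 1`.
  refine exists_salem_growth (f := f)
    (Q := (1 + X - (ℓ : ℤ[X])) * ∑ k ∈ Finset.range p, X ^ k + (ℓ : ℤ[X]))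
    (N := (1 + X) * ∑ k ∈ Finset.range p, X ^ k) (A := 1 + ((ℓ : ℤ[X]) - 1) * X ^ p)
    (D := ((ℓ : ℤ[X]) - 1) + X ^ p) ?_ ?_ ?_ ?_ ?_ ?_ ?_ ?_
  · have hφ : ∀ R : ℤ[X], ((R.map (Int.castRingHom ℂ) : ℂ[X]) : ℂ⟦X⟧) =
      (Polynomial.coeToPowerSeries.ringHom.comp (mapRingHom (Int.castRingHom ℂ))) R := fun _ => rfl
    have hX : (Polynomial.coeToPowerSeries.ringHom.comp (mapRingHom (Int.castRingHom ℂ))) X =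
      (PowerSeries.X : ℂ⟦X⟧) := by simp
    rw [hφ, hφ]
    simp only [map_add, map_mul, map_sub, map_one, map_sum, map_pow, map_natCast, hX]
    exact hF
  · intro x hx
    simp only [map_add, map_mul, map_one, map_sum, map_pow, aeval_X]
    have : 0 < ∑ k ∈ Finset.range p, x ^ k :=
      Finset.sum_pos (fun k _ => by positivity) (Finset.nonempty_range_iff.2 hp)
    positivity
  · obtain ⟨q, rfl⟩ := Nat.exists_eq_succ_of_ne_zero hp
    simp [eval_finsetSum, Finset.sum_range_succ']
  -- Here `Q(1) = ℓ - (ℓ - 2) p`, negative exactly when `(ℓ - 2)(2p - 2) > 4`.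
  · simp [eval_finsetSum]
    obtain ⟨l, rfl⟩ := Nat.exists_eq_add_of_le' (show 2 ≤ ℓ by omega)
    obtain ⟨q, rfl⟩ := Nat.exists_eq_succ_of_ne_zero hp
    rw [Nat.add_sub_cancel, show 2 * q.succ - 2 = 2 * q by omega] at hyp
    push_cast
    zify at hyp
    linarith
  · linear_combination (1 + X - (ℓ : ℤ[X])) * hgeom
  · simp [hp]
  · intro z hz
    have := norm_one_add_mul_lt ha (w := z ^ p) (by
      rw [norm_pow]
      exact pow_lt_one₀ (norm_nonneg _) hz hp)
    simpa using this
  · intro z hz h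
    simp at h ⊢
    field_simp
    linear_combination -h

theorem exists_salem_growth_of_odd {ℓ p : ℕ} (hℓ : 3 ≤ ℓ) (hyp : 4 < (ℓ - 2) * (2 * p + 1 - 2))
    {f : ℕ → ℕ}
    (hF : ((1 + PowerSeries.X - (ℓ : ℂ⟦X⟧)) * (∑ k ∈ Finset.range p, (PowerSeries.X : ℂ⟦X⟧) ^ k) *
        (1 + PowerSeries.X ^ p) + 2 * PowerSeries.X ^ p + (ℓ : ℂ⟦X⟧)) *
      PowerSeries.mk (fun n => (f n : ℂ)) =
        (1 + PowerSeries.X) * (∑ k ∈ Finset.range p, (PowerSeries.X : ℂ⟦X⟧) ^ k) *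
          (1 + PowerSeries.X ^ p) + 2 * PowerSeries.X ^ p) :
    ∃ lam : ℝ, IsSalemNumber lam ∧
      Tendsto (fun n : ℕ => (f n : ℝ) ^ ((1 : ℝ) / n)) atTop (𝓝 lam) ∧
      IsPoleOf (PowerSeries.mk (fun n => (f n : ℂ))) (lam : ℂ)⁻¹ ∧
      ∀ z : ℂ, IsPoleOf (PowerSeries.mk (fun n => (f n : ℂ))) z → z ≠ (lam : ℂ)⁻¹ →
        lam⁻¹ < ‖z‖ := by
  have hp : p ≠ 0 := by
    rintro rfl
    simp at hyp
  have hgeom : (1 - X) * ∑ k ∈ Finset.range p, (X : ℤ[X]) ^ k = 1 - X ^ p := mul_neg_geom_sum _ _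
  have h2 : ∀ z : ℂ, aeval z (2 : ℤ[X]) = 2 := fun z => map_ofNat _ 2
  have ha : (1 : ℝ) < ℓ - 1 := by
    have : (3 : ℝ) ≤ ℓ := by exact_mod_cast hℓ
    linarith
  -- As in the even case, now with `A / D = (1 + 2w + a w²) / (a + 2w + w²)`.
  refine exists_salem_growth (f := f)
    (Q := (1 + X - (ℓ : ℤ[X])) * (∑ k ∈ Finset.range p, X ^ k) * (1 + X ^ p) + 2 * X ^ p +
      (ℓ : ℤ[X]))
    (N := (1 + X) * (∑ k ∈ Finset.range p, X ^ k) * (1 + X ^ p) + 2 * X ^ p)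
    (A := 1 + 2 * X ^ p + ((ℓ : ℤ[X]) - 1) * (X ^ p) ^ 2)
    (D := ((ℓ : ℤ[X]) - 1) + 2 * X ^ p + (X ^ p) ^ 2) ?_ ?_ ?_ ?_ ?_ ?_ ?_ ?_
  · have hφ : ∀ R : ℤ[X], ((R.map (Int.castRingHom ℂ) : ℂ[X]) : ℂ⟦X⟧) =
      (Polynomial.coeToPowerSeries.ringHom.comp (mapRingHom (Int.castRingHom ℂ))) R := fun _ => rfl
    have hX : (Polynomial.coeToPowerSeries.ringHom.comp (mapRingHom (Int.castRingHom ℂ))) X =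
      (PowerSeries.X : ℂ⟦X⟧) := by simp
    rw [hφ, hφ]
    simp only [map_add, map_mul, map_sub, map_one, map_sum, map_pow, map_natCast, map_ofNat, hX]
    exact hF
  · intro x hx
    simp only [map_add, map_mul, map_one, map_sum, map_pow, map_ofNat, aeval_X]
    have : 0 < ∑ k ∈ Finset.range p, x ^ k :=
      Finset.sum_pos (fun k _ => by positivity) (Finset.nonempty_range_iff.2 hp)
    positivity
  · obtain ⟨q, rfl⟩ := Nat.exists_eq_succ_of_ne_zero hp
    simp [eval_finsetSum, Finset.sum_range_succ']
  -- Here `Q(1) = ℓ + 2 - 2 (ℓ - 2) p`, negative exactly when `(ℓ - 2)(2p - 1) > 4`.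
  · simp [eval_finsetSum]
    obtain ⟨l, rfl⟩ := Nat.exists_eq_add_of_le' (show 2 ≤ ℓ by omega)
    obtain ⟨q, rfl⟩ := Nat.exists_eq_succ_of_ne_zero hp
    rw [Nat.add_sub_cancel, show 2 * q.succ + 1 - 2 = 2 * q + 1 by omega] at hyp
    push_cast
    zify at hyp
    linarith
  · linear_combination (1 + X - (ℓ : ℤ[X])) * (1 + X ^ p) * hgeom
  · simp [hp]
  · intro z hz
    have := norm_one_add_mul_add_mul_lt ha (w := z ^ p) (by
      rw [norm_pow]
      exact pow_lt_one₀ (norm_nonneg _) hz hp)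
    simpa [h2] using this
  · intro z hz h
    simp [h2] at h ⊢
    field_simp
    linear_combination -h

theorem mainTheorem2 (ℓ m : ℕ) (hℓ : 3 ≤ ℓ) (hm : 3 ≤ m) (hyp : 4 < (ℓ - 2) * (m - 2))
    (o : TessellationCell ℓ m hℓ hm 0) :
    (tessellationGraph ℓ m hℓ hm).Connected ∧
      (∀ n : ℕ, (graphSphere (tessellationGraph ℓ m hℓ hm) o n).Finite) ∧
      ∃ lam : ℝ, IsSalemNumber lam ∧
        HasGrowthRate (tessellationGraph ℓ m hℓ hm) o lam ∧
        IsPoleOf (growthSeries (tessellationGraph ℓ m hℓ hm) o) ((lam : ℂ)⁻¹) ∧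
        ∀ z : ℂ, IsPoleOf (growthSeries (tessellationGraph ℓ m hℓ hm) o) z →
          z ≠ (lam : ℂ)⁻¹ → lam⁻¹ < ‖z‖ := by
  refine ⟨tessellationGraph_connected hyp, graphSphere_finite hyp o, ?_⟩
  have hF := growthSeries_tessellation hyp o
  have hH := tessellationMatrix_isHyperbolic (hℓ := hℓ) (hm := hm) hyp
  rcases Nat.even_or_odd' m with ⟨p, hp | hp⟩
  · have h := hH.weightSeries_of_even (tessellationMatrix ℓ m hℓ hm).toCoxeterSystem hp
    rw [← hF] at h
    exact exists_salem_growth_of_even hℓ (hp ▸ hyp) h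
  · have h := hH.weightSeries_of_odd (tessellationMatrix ℓ m hℓ hm).toCoxeterSystem hp
    rw [← hF] at h
    exact exists_salem_growth_of_odd hℓ (hp ▸ hyp) h

end Main
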